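/- Let $L^2=L^2(\mathbb R^3,\mathbb C)$, $H^2=H^2(\mathbb R^3,\mathbb C)$ with $\|f\|_{H^2}^2=\|f\|_{L^2}^2+\|\Delta f\|_{L^2}^2$, and $\langle f|A|g\rangle=\int_{\mathbb R^3}\overline{f}\,Ag\,dx$. Let $T>0$, $\alpha>0$, let $V,\mu\in W^{2,\infty}(\mathbb R^3,\mathbb R)$, $H=-\Delta+V$, let $\psi_0\in H^2$ with $\|\psi_0\|_{L^2}=1$, and let $O$ be a bounded operator on $L^2$, symmetric and positive for the $L^2$ inner product, that maps $H^2$ boundedly into itself; $\|O\|_*$ is its operator norm on $L^2$. For $\varepsilon\in L^2(0,T)=L^2((0,T),\mathbb R)$ let $\psi$ and $\chi$ be the solutions on $[0,T]$, in $L^\infty(0,T;H^2)\cap W^{1,1}(0,T;L^2)$, of $$i\partial_t\psi-[H-\mu\varepsilon(t)]\psi=0,\ \psi(0)=\psi_0,\qquad i\partial_t\chi-[H-\mu\varepsilon(t)]\chi=0,\ \chi(T)=O\psi(T),$$ and put $$J(\varepsilon)=\langle\psi(T)|O|\psi(T)\rangle-\alpha\int_0^T\varepsilon(t)^2dt,\qquad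 \gamma(\varepsilon)(t)=\operatorname{Im}\langle\chi(t)|\mu|\psi(t)\rangle .$$ Suppose that $\alpha>6T\|\mu\|_{L^\infty}^2\|O\|_*$. Then $\psi$ and $\chi$ exist and are unique for every $\varepsilon\in L^2(0,T)$, the maps $J:L^2(0,T)\to\mathbb R$ and $\gamma:L^2(0,T)\to L^2(0,T)$ are well defined and Fréchet differentiable, and $\nabla J:L^2(0,T)\to L^2(0,T)$ is Fréchet differentiable. Moreover, for every $\varepsilon\in L^2(0,T)$, the derivative of $\nabla J$ at $\varepsilon$, that is, the Hessian operator of $J$, is $$H_J(\varepsilon)=-2\big(\alpha I+D\gamma(\varepsilon)\big),$$ the operator norm of $\frac1\alpha D\gamma(\varepsilon)$ on $L^2(0,T)$ is less than $1$, and $H_J(\varepsilon)$ is invertible, with bounded inverse, on $L^2(0,T)$. -/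

import Mathlib

open MeasureTheory
open scoped ENNReal SchwartzMap Laplacian ContDiff

noncomputable section

/-- The space `ℝ³`. -/
abbrev E3 : Type := EuclideanSpace ℝ (Fin 3)

/-- The complex Hilbert space `L²(ℝ³, ℂ)`. Its inner product is `∫ conj f * g`. -/
abbrev L2 : Type := Lp ℂ 2 (volume : Measure E3)

/-- The space `L^∞(ℝ³, ℝ)`; its norm is the essential supremum. -/
abbrev LInfty : Type := Lp ℝ ∞ (volume : Measure E3)

/-- The real Hilbert space `L²(0,T)` of controls. -/
abbrev L2T (T : ℝ) : Type := Lp ℝ 2 (volume.restrict (Set.Ioo (0 : ℝ) T))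

/-- `g` is the weak partial derivative `∂ᵢ f`. -/
def HasWeakPartial (i : Fin 3) (f g : LInfty) : Prop :=
  ∀ φ : E3 → ℝ, ContDiff ℝ ∞ φ → HasCompactSupport φ →
    ∫ x, f x * fderiv ℝ φ x (EuclideanSpace.single i 1) = -∫ x, g x * φ x

/-- `f ∈ W^{2,∞}(ℝ³, ℝ)`: all weak derivatives of order at most two are in `L^∞`. -/
def MemW2Infty (f : LInfty) : Prop :=
  ∀ i, ∃ g : LInfty, HasWeakPartial i f g ∧ ∀ j, ∃ h : LInfty, HasWeakPartial j g h

/-- `f ∈ H²(ℝ³, ℂ)`. -/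
def MemH2 (f : L2) : Prop :=
  TemperedDistribution.MemSobolev 2 2 (f : 𝓢'(E3, ℂ))

open Classical in
/-- The distributional Laplacian of `f`, as an element of `L²`, when it is one (in particular for
`f ∈ H²`, see `MemH2.laplacian_eq`); it is only used for `f ∈ H²`. -/
def lap (f : L2) : L2 :=
  if h : ∃ g : L2, Δ (f : 𝓢'(E3, ℂ)) = (g : 𝓢'(E3, ℂ)) then h.choose else 0

theorem MemH2.laplacian_eq {f : L2} (hf : MemH2 f) :
    Δ (f : 𝓢'(E3, ℂ)) = (lap f : 𝓢'(E3, ℂ)) := by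
  have h : ∃ g : L2, Δ (f : 𝓢'(E3, ℂ)) = (g : 𝓢'(E3, ℂ)) := by
    have := TemperedDistribution.MemSobolev.laplacian hf
    rw [sub_self] at this
    exact TemperedDistribution.memSobolev_zero_iff.mp this
  rw [lap, dif_pos h]
  exact h.choose_spec

/-- The `H²` norm, `‖f‖²_{H²} = ‖f‖²_{L²} + ‖Δ f‖²_{L²}`, for `f ∈ H²`. -/
def h2Norm (f : L2) : ℝ := Real.sqrt (‖f‖ ^ 2 + ‖lap f‖ ^ 2)

/-- Multiplication of `f ∈ L²` by the real function `m ∈ L^∞`. -/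
def mulL2 (m : LInfty) (f : L2) : L2 := m • f

/-- `H u = - Δ u + V u`, for `u ∈ H²`. -/
def hamiltonian (V : LInfty) (u : L2) : L2 := -lap u + mulL2 V u

/-- `O` is a positive symmetric operator (for the `L²` inner product), bounded on `L²` and, by
restriction, bounded on `H²`. -/
structure IsObservable (O : L2 →L[ℂ] L2) : Prop where
  positive : O.IsPositive
  bounded_H2 : ∃ C : ℝ, ∀ f : L2, MemH2 f → MemH2 (O f) ∧ h2Norm (O f) ≤ C * h2Norm f

/-- `u` is a strong solution on `[0,T]` of `i ∂ₜ u - [H - μ ε(t)] u = 0`, `H = - Δ + V`: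
`u` belongs to `L^∞(0,T; H²)`, it is the primitive of a function `u'` that is integrable
with values in `L²` (so `u` is continuous in `L²`, with weak derivative `u'`),
and the equation holds in `L²` at almost every time. -/
def IsSchrodingerSolution (V μ : LInfty) (T : ℝ) (ε : L2T T) (u : ℝ → L2) : Prop :=
  (∃ C : ℝ, ∀ᵐ t ∂(volume.restrict (Set.Ioo 0 T)), MemH2 (u t) ∧ h2Norm (u t) ≤ C) ∧
  ∃ u' : ℝ → L2, IntervalIntegrable u' volume 0 T ∧
    (∀ t ∈ Set.Icc 0 T, u t = u 0 + ∫ s in (0 : ℝ)..t, u' s) ∧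
    ∀ᵐ t ∂(volume.restrict (Set.Ioo 0 T)),
      Complex.I • u' t - (hamiltonian V (u t) - ((ε t : ℝ) : ℂ) • mulL2 μ (u t)) = 0

/-- `ψ` solves the state equation, with `ψ(0) = ψ₀`. -/
def IsState (V μ : LInfty) (T : ℝ) (ψ₀ : L2) (ε : L2T T) (ψ : ℝ → L2) : Prop :=
  IsSchrodingerSolution V μ T ε ψ ∧ ψ 0 = ψ₀

open Classical in
/-- The solution `ψ` of the state equation for the control `ε`. -/
def state (V μ : LInfty) (T : ℝ) (ψ₀ : L2) (ε : L2T T) : ℝ → L2 :=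
  if h : ∃ ψ, IsState V μ T ψ₀ ε ψ then h.choose else 0

/-- `χ` solves the adjoint equation, with `χ(T) = O ψ(T)`. -/
def IsAdjointState (V μ : LInfty) (T : ℝ) (O : L2 →L[ℂ] L2) (ψ₀ : L2) (ε : L2T T)
    (χ : ℝ → L2) : Prop :=
  IsSchrodingerSolution V μ T ε χ ∧ χ T = O (state V μ T ψ₀ ε T)

open Classical in
/-- The solution `χ` of the adjoint equation for the control `ε`. -/
def adjointState (V μ : LInfty) (T : ℝ) (O : L2 →L[ℂ] L2) (ψ₀ : L2) (ε : L2T T) : ℝ → L2 :=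
  if h : ∃ χ, IsAdjointState V μ T O ψ₀ ε χ then h.choose else 0

/-- The cost functional `J(ε) = ⟨ψ(T)|O|ψ(T)⟩ - α ∫₀ᵀ ε²`. -/
def costJ (V μ : LInfty) (T α : ℝ) (O : L2 →L[ℂ] L2) (ψ₀ : L2) (ε : L2T T) : ℝ :=
  (inner ℂ (state V μ T ψ₀ ε T) (O (state V μ T ψ₀ ε T))).re
    - α * ∫ t in Set.Ioo 0 T, (ε t) ^ 2

/-- The function `t ↦ Im ⟨χ(t)|μ|ψ(t)⟩`. -/
def gammaFun (V μ : LInfty) (T : ℝ) (O : L2 →L[ℂ] L2) (ψ₀ : L2) (ε : L2T T) (t : ℝ) : ℝ :=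
  (inner ℂ (adjointState V μ T O ψ₀ ε t) (mulL2 μ (state V μ T ψ₀ ε t))).im

open Classical in
/-- The map `γ : ε ↦ Im ⟨χ|μ|ψ⟩` of `L²(0,T)` into itself. (The function is continuous
on `[0,T]` because `ψ` and `χ` are, so it does define an element of `L²(0,T)`.) -/
def gammaMap (V μ : LInfty) (T : ℝ) (O : L2 →L[ℂ] L2) (ψ₀ : L2) (ε : L2T T) : L2T T :=
  if h : MemLp (gammaFun V μ T O ψ₀ ε) 2 (volume.restrict (Set.Ioo 0 T)) then h.toLp else 0

/-- The operator `H_J(ε) : ε' ↦ -2 (α ε' + Dγ(ε)[ε'])` on `L²(0,T)`, where `Dγ` is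
the Fréchet derivative. -/
def hessianJ (V μ : LInfty) (T α : ℝ) (O : L2 →L[ℂ] L2) (ψ₀ : L2) (ε : L2T T) :
    L2T T →L[ℝ] L2T T :=
  (-2 : ℝ) • (α • ContinuousLinearMap.id ℝ (L2T T) + fderiv ℝ (gammaMap V μ T O ψ₀) ε)

end

/-! Set y(t) = e^{-itΔ}u(t). The Schrödinger equation becomes y' = p(t)y + ε(t)q(t)y, where p(t) =
-i e^{-itΔ}V e^{itΔ} and q(t) = i e^{-itΔ}μ e^{itΔ} are bounded, strongly continuous and
skew-adjoint on `L2`. The unbounded operator is gone, and the rest is a bilinear control system with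
bounded coefficients.

Differentiability. In integrated form the equation is y = f + K_ε y on C([0,T], L²), with K_ε affine
in ε and of Volterra type. Some power of K_ε is a contraction, so 1 - K_ε is invertible for every ε
(`IsVolterra.isUnit_one_sub`). Inversion is differentiable, hence so is ε ↦ (1 - K_ε)⁻¹, and with it
ψ, χ, J and γ (`ControlSystem.hasFDerivAt_sol`).

Gradient. Pairing χ with the linearized state δψ, skew-adjointness cancels p and εq, and only the
source h q ψ survives. This gives ∇J(ε) = -2(αε + γ(ε)), whose derivative is the claimed Hessian
operator.

Bound. The same pairing of a trajectory with itself is an energy estimate with constant 2√T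
(`ControlSystem.IsTraj.norm_le`). It gives ‖δψ‖ ≤ 2√T‖μ‖‖h‖ and ‖δχ‖ ≤ 4√T‖μ‖‖O‖‖h‖ in the sup norm.
Since γ is bilinear in (χ, ψ) with constant √T‖μ‖, ‖Dγ‖ ≤ (2 + 4)T‖μ‖²‖O‖ < α, and a Neumann series
inverts α + Dγ.

Strong solutions. H² is the range of the resolvent `res`, and multiplication by V ∈ W^{2,∞}
preserves it, so V `res` = `res` M with M bounded on L² (`MemW2Infty.exists_conj`). Solving the
system built from such M in L² and applying `res` yields solutions with values in H². Uniqueness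
follows from Duhamel's formula, which makes any strong solution a trajectory of the bounded system.
-/

/-! ### Product rule for primitives of Bochner integrable functions -/

section ProductRule

/-- Allows a Banach-valued function to inherit absolute continuity from a real primitive that
dominates its increments. -/
theorem AbsolutelyContinuousOnInterval.of_dist_le {X Z : Type*} [PseudoMetricSpace X]
    [PseudoMetricSpace Z] {f : ℝ → X} {g : ℝ → Z} {a b : ℝ}
    (hg : AbsolutelyContinuousOnInterval g a b)
    (h : ∀ x ∈ Set.uIcc a b, ∀ y ∈ Set.uIcc a b, dist (f x) (f y) ≤ dist (g x) (g y)) :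
    AbsolutelyContinuousOnInterval f a b := by
  rw [absolutelyContinuousOnInterval_iff] at hg ⊢
  intro ε hε
  obtain ⟨δ, hδ, H⟩ := hg ε hε
  refine ⟨δ, hδ, fun I hI hlen => lt_of_le_of_lt ?_ (H I hI hlen)⟩
  exact Finset.sum_le_sum fun i hi => h _ (hI.1 i hi).1 _ (hI.1 i hi).2

variable {E F G : Type*} [NormedAddCommGroup E] [NormedSpace ℝ E] [CompleteSpace E]
  [NormedAddCommGroup F] [NormedSpace ℝ F] [CompleteSpace F]
  [NormedAddCommGroup G] [NormedSpace ℝ G] [CompleteSpace G]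

omit [CompleteSpace E] in
theorem continuousOn_of_eq_primitive {y y' : ℝ → E} {a b : ℝ}
    (hy' : IntervalIntegrable y' volume a b)
    (hy : ∀ t ∈ Set.uIcc a b, y t = y a + ∫ s in a..t, y' s) : ContinuousOn y (Set.uIcc a b) := by
  refine ContinuousOn.congr ?_ hy
  exact continuousOn_const.add
    (intervalIntegral.continuousOn_primitive_interval' hy' Set.left_mem_uIcc)

omit [CompleteSpace E] in
theorem norm_sub_le_abs_integral_of_eq_primitive {y y' : ℝ → E} {a b : ℝ}
    (hy' : IntervalIntegrable y' volume a b)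
    (hy : ∀ t ∈ Set.uIcc a b, y t = y a + ∫ s in a..t, y' s)
    {s t : ℝ} (hs : s ∈ Set.uIcc a b) (ht : t ∈ Set.uIcc a b) :
    ‖y s - y t‖ ≤ |∫ r in t..s, ‖y' r‖| := by
  have h1 : IntervalIntegrable y' volume a s :=
    hy'.mono_set (Set.uIcc_subset_uIcc Set.left_mem_uIcc hs)
  have h2 : IntervalIntegrable y' volume a t :=
    hy'.mono_set (Set.uIcc_subset_uIcc Set.left_mem_uIcc ht)
  rw [hy s hs, hy t ht, add_sub_add_left_eq_sub, intervalIntegral.integral_interval_sub_left h1 h2]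
  exact intervalIntegral.norm_integral_le_abs_integral_norm

/-- Product rule for a bilinear map and two primitives of integrable functions. -/
theorem bilin_primitive (B : E →L[ℝ] F →L[ℝ] G) {y y' : ℝ → E} {z z' : ℝ → F} {a b : ℝ}
    (hy' : IntervalIntegrable y' volume a b) (hz' : IntervalIntegrable z' volume a b)
    (hy : ∀ t ∈ Set.uIcc a b, y t = y a + ∫ s in a..t, y' s)
    (hz : ∀ t ∈ Set.uIcc a b, z t = z a + ∫ s in a..t, z' s) :
    IntervalIntegrable (fun s => B (y' s) (z s) + B (y s) (z' s)) volume a b ∧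
    B (y b) (z b) = B (y a) (z a) + ∫ s in a..b, (B (y' s) (z s) + B (y s) (z' s)) := by
  have hyc := continuousOn_of_eq_primitive hy' hy
  have hzc := continuousOn_of_eq_primitive hz' hz
  obtain ⟨My, hMy⟩ := isCompact_uIcc.exists_bound_of_continuousOn hyc
  obtain ⟨Mz, hMz⟩ := isCompact_uIcc.exists_bound_of_continuousOn hzc
  have hMy0 : 0 ≤ My := (norm_nonneg _).trans (hMy a Set.left_mem_uIcc)
  have hMz0 : 0 ≤ Mz := (norm_nonneg _).trans (hMz a Set.left_mem_uIcc)
  have hI : IntervalIntegrable (fun s => B (y' s) (z s) + B (y s) (z' s)) volume a b := by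
    rw [intervalIntegrable_iff] at hy' hz' ⊢
    have hsub : Set.uIoc a b ⊆ Set.uIcc a b := Set.uIoc_subset_uIcc
    refine Integrable.add ?_ ?_
    · refine B.integrable_of_bilin_of_bdd_right Mz hy'
        ((hzc.mono hsub).aestronglyMeasurable measurableSet_uIoc) ?_
      exact (ae_restrict_iff' measurableSet_uIoc).2 (.of_forall fun s hs => hMz s (hsub hs))
    · refine B.integrable_of_bilin_of_bdd_left My
        ((hyc.mono hsub).aestronglyMeasurable measurableSet_uIoc) ?_ hz'
      exact (ae_restrict_iff' measurableSet_uIoc).2 (.of_forall fun s hs => hMy s (hsub hs))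
  refine ⟨hI, ?_⟩
  set f' : ℝ → G := fun s => B (y' s) (z s) + B (y s) (z' s) with hf'
  -- It suffices that `g` is constant. It has derivative zero almost everywhere, and it is
  -- absolutely continuous because its increments are dominated by those of a primitive of `N'`.
  set g : ℝ → G := fun t => B (y t) (z t) - ∫ s in a..t, f' s with hg
  set N' : ℝ → ℝ := fun s => ‖B‖ * (Mz * ‖y' s‖ + My * ‖z' s‖) + ‖f' s‖ with hN'
  have hN'i : IntervalIntegrable N' volume a b :=
    (((hy'.norm.const_mul _).add (hz'.norm.const_mul _)).const_mul _).add hI.norm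
  have hmono : ∀ {s t}, s ∈ Set.uIcc a b → t ∈ Set.uIcc a b → Set.uIcc t s ⊆ Set.uIcc a b :=
    fun hs ht => Set.uIcc_subset_uIcc ht hs
  have hac : AbsolutelyContinuousOnInterval g a b := by
    refine AbsolutelyContinuousOnInterval.of_dist_le
      (hN'i.absolutelyContinuousOnInterval_intervalIntegral (c := a) Set.left_mem_uIcc) ?_
    intro s hs t ht
    have hst := hmono hs ht
    rw [dist_eq_norm, dist_eq_norm, intervalIntegral.integral_interval_sub_left
      (hN'i.mono_set (Set.uIcc_subset_uIcc Set.left_mem_uIcc hs))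
      (hN'i.mono_set (Set.uIcc_subset_uIcc Set.left_mem_uIcc ht))]
    have e1 : g s - g t = B (y s - y t) (z s) + B (y t) (z s - z t) - ∫ r in t..s, f' r := by
      have h4 : (∫ r in a..s, f' r) - ∫ r in a..t, f' r = ∫ r in t..s, f' r :=
        intervalIntegral.integral_interval_sub_left
          (hI.mono_set (Set.uIcc_subset_uIcc Set.left_mem_uIcc hs))
          (hI.mono_set (Set.uIcc_subset_uIcc Set.left_mem_uIcc ht))
      rw [← h4]
      simp only [hg, map_sub, sub_apply]
      abel
    have a1 := norm_sub_le_abs_integral_of_eq_primitive hy' hy hs ht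
    have a2 := norm_sub_le_abs_integral_of_eq_primitive hz' hz hs ht
    have a3 : ‖∫ r in t..s, f' r‖ ≤ |∫ r in t..s, ‖f' r‖| :=
      intervalIntegral.norm_integral_le_abs_integral_norm
    have b1 : ‖B (y s - y t) (z s)‖ ≤ ‖B‖ * (Mz * |∫ r in t..s, ‖y' r‖|) := by
      refine (B.le_opNorm₂ _ _).trans ?_
      rw [mul_assoc, mul_comm Mz]
      gcongr
      exact hMz s hs
    have b2 : ‖B (y t) (z s - z t)‖ ≤ ‖B‖ * (My * |∫ r in t..s, ‖z' r‖|) := by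
      refine (B.le_opNorm₂ _ _).trans ?_
      rw [mul_assoc]
      gcongr
      exact hMy t ht
    have e2 : ∫ r in t..s, N' r = ‖B‖ * (Mz * (∫ r in t..s, ‖y' r‖) + My * ∫ r in t..s, ‖z' r‖)
        + ∫ r in t..s, ‖f' r‖ := by
      have i1 := (hy'.mono_set hst).norm
      have i2 := (hz'.mono_set hst).norm
      have i3 := (hI.mono_set hst).norm
      rw [hN', intervalIntegral.integral_add (((i1.const_mul _).add (i2.const_mul _)).const_mul _) i3,
        intervalIntegral.integral_const_mul,
        intervalIntegral.integral_add (i1.const_mul _) (i2.const_mul _),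
        intervalIntegral.integral_const_mul, intervalIntegral.integral_const_mul]
    have hsign : |∫ r in t..s, N' r| = ‖B‖ * (Mz * |∫ r in t..s, ‖y' r‖| +
        My * |∫ r in t..s, ‖z' r‖|) + |∫ r in t..s, ‖f' r‖| := by
      rw [e2]
      rcases le_total t s with h | h
      · have p1 := intervalIntegral.integral_nonneg (f := fun r => ‖y' r‖) (μ := volume) h
          fun _ _ => norm_nonneg _
        have p2 := intervalIntegral.integral_nonneg (f := fun r => ‖z' r‖) (μ := volume) h
          fun _ _ => norm_nonneg _
        have p3 := intervalIntegral.integral_nonneg (f := fun r => ‖f' r‖) (μ := volume) h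
          fun _ _ => norm_nonneg _
        rw [abs_of_nonneg p1, abs_of_nonneg p2, abs_of_nonneg p3, abs_of_nonneg (by positivity)]
      · have p1 := intervalIntegral.integral_nonneg (f := fun r => ‖y' r‖) (μ := volume) h
          fun _ _ => norm_nonneg _
        have p2 := intervalIntegral.integral_nonneg (f := fun r => ‖z' r‖) (μ := volume) h
          fun _ _ => norm_nonneg _
        have p3 := intervalIntegral.integral_nonneg (f := fun r => ‖f' r‖) (μ := volume) h
          fun _ _ => norm_nonneg _
        rw [intervalIntegral.integral_symm s t, intervalIntegral.integral_symm s t,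
          intervalIntegral.integral_symm s t, abs_neg, abs_neg, abs_neg,
          abs_of_nonneg p1, abs_of_nonneg p2, abs_of_nonneg p3, mul_neg, mul_neg, ← neg_add,
          mul_neg, ← neg_add, abs_neg, abs_of_nonneg (by positivity)]
    rw [Real.norm_eq_abs, hsign, e1]
    calc _ ≤ ‖B (y s - y t) (z s)‖ + ‖B (y t) (z s - z t)‖ + ‖∫ r in t..s, f' r‖ :=
          (norm_sub_le _ _).trans (by gcongr; exact norm_add_le _ _)
      _ ≤ _ := by rw [mul_add]; linarith
  have hder : ∀ᵐ t, t ∈ Set.uIcc a b → HasDerivAt g 0 t := by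
    have hne : ∀ c : ℝ, ∀ᵐ t : ℝ, t ≠ c := fun c => by simp [ae_iff, measure_singleton]
    filter_upwards [hy'.ae_hasDerivAt_integral, hz'.ae_hasDerivAt_integral,
      hI.ae_hasDerivAt_integral, hne a, hne b] with t h1 h2 h3 hta htb ht
    have hnhds : Set.uIcc a b ∈ nhds t := by
      rw [Set.uIcc] at ht ⊢
      refine Icc_mem_nhds ?_ ?_
      · refine lt_of_le_of_ne ht.1 ?_
        rcases min_choice a b with h | h <;> rw [h] <;> [exact hta.symm; exact htb.symm]
      · refine lt_of_le_of_ne ht.2 ?_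
        rcases max_choice a b with h | h <;> rw [h] <;> [exact hta; exact htb]
    have dy : HasDerivAt y (y' t) t :=
      ((h1 ht a Set.left_mem_uIcc).const_add (y a)).congr_of_eventuallyEq
        (Filter.eventually_of_mem hnhds hy)
    have dz : HasDerivAt z (z' t) t :=
      ((h2 ht a Set.left_mem_uIcc).const_add (z a)).congr_of_eventuallyEq
        (Filter.eventually_of_mem hnhds hz)
    have db : HasDerivAt (fun t => B (y t) (z t)) (f' t) t := by
      have := B.hasFDerivAt_of_bilinear dy.hasFDerivAt dz.hasFDerivAt
      have := this.hasDerivAt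
      convert this using 1
      simp [hf', add_comm]
    have := db.sub (h3 ht a Set.left_mem_uIcc)
    rw [sub_self] at this
    exact this
  obtain ⟨c, hc⟩ := hac.const_of_ae_hasDerivAt_zero hder
  have ha := hc a Set.left_mem_uIcc
  have hb := hc b Set.right_mem_uIcc
  simp only [hg, intervalIntegral.integral_same, sub_zero] at ha hb
  rw [ha, ← hb]
  abel

end ProductRule

/-! ### Volterra operators on C([0,T], X) with coefficients in L²(0,T) -/

section Volterra

/-- A bounded, strongly continuous family of bounded operators. -/
structure BddFamily {X : Type*} [NormedAddCommGroup X] [NormedSpace ℝ X]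
    (q : ℝ → X →L[ℝ] X) (C : ℝ) : Prop where
  cont : ∀ x, Continuous fun s => q s x
  bound : ∀ s, ‖q s‖ ≤ C

variable {X : Type*} [NormedAddCommGroup X] [NormedSpace ℝ X] {T : ℝ}

theorem BddFamily.nonneg {q : ℝ → X →L[ℝ] X} {C : ℝ} (hq : BddFamily q C) : 0 ≤ C :=
  (norm_nonneg _).trans (hq.bound 0)

theorem BddFamily.norm_apply_le {q : ℝ → X →L[ℝ] X} {C : ℝ} (hq : BddFamily q C) (s : ℝ) (x : X) :
    ‖q s x‖ ≤ C * ‖x‖ :=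
  (q s).le_of_opNorm_le (hq.bound s) x

theorem BddFamily.continuousOn_apply {q : ℝ → X →L[ℝ] X} {C : ℝ} (hq : BddFamily q C) {S : Set ℝ}
    {y : ℝ → X} (hy : ContinuousOn y S) : ContinuousOn (fun s => q s (y s)) S := by
  intro t ht
  have h1 : Filter.Tendsto (fun s => q s (y t)) (nhdsWithin t S) (nhds (q t (y t))) :=
    ((hq.cont (y t)).tendsto t).mono_left nhdsWithin_le_nhds
  have h2 : Filter.Tendsto (fun s => q s (y s - y t)) (nhdsWithin t S) (nhds 0) := by
    refine squeeze_zero_norm (fun s => hq.norm_apply_le s _) ?_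
    have := ((hy t ht).sub_const (y t)).norm.const_mul C
    simpa using this
  have := h1.add h2
  simpa [ContinuousWithinAt] using this

theorem BddFamily.continuous_apply {q : ℝ → X →L[ℝ] X} {C : ℝ} (hq : BddFamily q C)
    {y : ℝ → X} (hy : Continuous y) : Continuous fun s => q s (y s) :=
  continuousOn_univ.1 (hq.continuousOn_apply hy.continuousOn)

theorem L2T.integrableOn (h : L2T T) : IntegrableOn h (Set.Ioo 0 T) :=
  (Lp.memLp h).integrable (by norm_num)

theorem L2T.integrableOn_sq (h : L2T T) : IntegrableOn (fun s => h s ^ 2) (Set.Ioo 0 T) :=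
  (Lp.memLp h).integrable_sq

theorem L2T.norm_sq (h : L2T T) : ‖h‖ ^ 2 = ∫ s in Set.Ioo 0 T, h s ^ 2 := by
  rw [← real_inner_self_eq_norm_sq, L2.inner_def]
  simp [pow_two]

theorem L2T.intervalIntegrable (h : L2T T) {s t : ℝ} (hs : s ∈ Set.Icc 0 T)
    (ht : t ∈ Set.Icc 0 T) : IntervalIntegrable h volume s t := by
  have hT : 0 ≤ T := hs.1.trans hs.2
  have h0 : IntervalIntegrable h volume 0 T := by
    rw [intervalIntegrable_iff_integrableOn_Ioo_of_le hT]
    exact h.integrableOn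
  refine h0.mono_set (Set.uIcc_subset_uIcc ?_ ?_) <;> rwa [Set.uIcc_of_le hT]

theorem L2T.intervalIntegrable_smul (h : L2T T) {f : ℝ → X} (hf : ContinuousOn f (Set.Icc 0 T))
    {s t : ℝ} (hs : s ∈ Set.Icc 0 T) (ht : t ∈ Set.Icc 0 T) :
    IntervalIntegrable (fun r => h r • f r) volume s t :=
  (h.intervalIntegrable hs ht).smul_continuousOn (hf.mono (Set.uIcc_subset_Icc hs ht))

/-- Cauchy-Schwarz for `∫ h • f` with `h ∈ L²(0,T)` and `f` continuous. -/
theorem L2T.norm_integral_smul_sq_le (h : L2T T) {f : ℝ → X} (hf : ContinuousOn f (Set.Icc 0 T))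
    {s t : ℝ} (hs : s ∈ Set.Icc 0 T) (ht : t ∈ Set.Icc 0 T) :
    ‖∫ r in s..t, h r • f r‖ ^ 2 ≤ ‖h‖ ^ 2 * |∫ r in s..t, ‖f r‖ ^ 2| := by
  have hT : 0 ≤ T := hs.1.trans hs.2
  have hsub : Set.uIoc s t ⊆ Set.Icc 0 T := Set.uIoc_subset_uIcc.trans (Set.uIcc_subset_Icc hs ht)
  have hle : volume.restrict (Set.uIoc s t) ≤ volume.restrict (Set.Ioo 0 T) := by
    rw [← Measure.restrict_congr_set (Ioo_ae_eq_Icc (μ := volume) (a := (0 : ℝ)) (b := T)).symm]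
    exact Measure.restrict_mono hsub le_rfl
  have m1 : MemLp (fun r => ‖h r‖) (ENNReal.ofReal 2) (volume.restrict (Set.uIoc s t)) := by
    rw [ENNReal.ofReal_ofNat]
    exact ((Lp.memLp h).mono_measure hle).norm
  have hfm : AEStronglyMeasurable f (volume.restrict (Set.uIoc s t)) :=
    (hf.mono hsub).aestronglyMeasurable measurableSet_uIoc
  obtain ⟨M, hM⟩ := isCompact_Icc.exists_bound_of_continuousOn hf
  have m2 : MemLp (fun r => ‖f r‖) (ENNReal.ofReal 2) (volume.restrict (Set.uIoc s t)) := by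
    have := isFiniteMeasure_of_le _ hle
    refine (MemLp.of_bound hfm M ?_).norm
    exact (ae_restrict_iff' measurableSet_uIoc).2 (.of_forall fun r hr => hM r (hsub hr))
  have key := integral_mul_le_Lp_mul_Lq_of_nonneg Real.HolderConjugate.two_two
    (.of_forall fun r => norm_nonneg (h r)) (.of_forall fun r => norm_nonneg (f r)) m1 m2
  have hA : 0 ≤ ∫ r in Set.uIoc s t, ‖h r‖ ^ 2 := integral_nonneg fun _ => by positivity
  have hB : 0 ≤ ∫ r in Set.uIoc s t, ‖f r‖ ^ 2 := integral_nonneg fun _ => by positivity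
  have hAh : ∫ r in Set.uIoc s t, ‖h r‖ ^ 2 ≤ ‖h‖ ^ 2 := by
    rw [L2T.norm_sq]
    simp only [Real.norm_eq_abs, sq_abs]
    exact integral_mono_measure hle (.of_forall fun _ => sq_nonneg _) h.integrableOn_sq
  have h1 : ‖∫ r in s..t, h r • f r‖ ≤ ∫ r in Set.uIoc s t, ‖h r‖ * ‖f r‖ := by
    refine intervalIntegral.norm_integral_le_integral_norm_uIoc.trans_eq ?_
    simp [norm_smul]
  have h2 : |∫ r in s..t, ‖f r‖ ^ 2| = ∫ r in Set.uIoc s t, ‖f r‖ ^ 2 := by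
    rw [intervalIntegral.abs_integral_eq_abs_integral_uIoc, abs_of_nonneg hB]
  rw [h2]
  simp only [Real.rpow_ofNat, ← Real.sqrt_eq_rpow] at key
  calc _ ≤ (√(∫ r in Set.uIoc s t, ‖h r‖ ^ 2) * √(∫ r in Set.uIoc s t, ‖f r‖ ^ 2)) ^ 2 := by
        gcongr; exact h1.trans key
    _ = (∫ r in Set.uIoc s t, ‖h r‖ ^ 2) * ∫ r in Set.uIoc s t, ‖f r‖ ^ 2 := by
        rw [mul_pow, Real.sq_sqrt hA, Real.sq_sqrt hB]
    _ ≤ _ := by gcongr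

theorem L2T.norm_integral_smul_le (h : L2T T) {f : ℝ → X} (hf : ContinuousOn f (Set.Icc 0 T))
    {M : ℝ} (hM : ∀ r ∈ Set.Icc 0 T, ‖f r‖ ≤ M)
    {s t : ℝ} (hs : s ∈ Set.Icc 0 T) (ht : t ∈ Set.Icc 0 T) :
    ‖∫ r in s..t, h r • f r‖ ≤ √T * ‖h‖ * M := by
  have hT : 0 ≤ T := hs.1.trans hs.2
  have hM0 : 0 ≤ M := (norm_nonneg _).trans (hM s hs)
  refine le_of_sq_le_sq ?_ (by positivity)
  refine (h.norm_integral_smul_sq_le hf hs ht).trans ?_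
  have : |∫ r in s..t, ‖f r‖ ^ 2| ≤ M ^ 2 * T := by
    rw [← Real.norm_eq_abs]
    refine (intervalIntegral.norm_integral_le_of_norm_le_const (C := M ^ 2) ?_).trans ?_
    · intro r hr
      have hr' := Set.uIcc_subset_Icc hs ht (Set.uIoc_subset_uIcc hr)
      rw [Real.norm_eq_abs, abs_of_nonneg (by positivity)]
      gcongr
      exact hM r hr'
    · gcongr
      rw [abs_le]
      constructor <;> linarith [hs.1, hs.2, ht.1, ht.2]
  calc _ ≤ ‖h‖ ^ 2 * (M ^ 2 * T) := by gcongr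
    _ = _ := by rw [mul_pow, mul_pow, Real.sq_sqrt hT]; ring

/-- `K` is dominated by the primitive based at `τ`. -/
def IsVolterra (hT : 0 ≤ T) (τ : Set.Icc 0 T)
    (K : C(Set.Icc 0 T, X) →L[ℝ] C(Set.Icc 0 T, X)) : Prop :=
  ∃ N : ℝ, 0 ≤ N ∧ ∀ y t, ‖K y t‖ ^ 2 ≤ N * |∫ s in (τ : ℝ)..t, ‖Set.IccExtend hT y s‖ ^ 2|

theorem IsVolterra.add {hT : 0 ≤ T} {τ : Set.Icc 0 T}
    {K L : C(Set.Icc 0 T, X) →L[ℝ] C(Set.Icc 0 T, X)} (hK : IsVolterra hT τ K)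
    (hL : IsVolterra hT τ L) : IsVolterra hT τ (K + L) := by
  obtain ⟨M, hM0, hM⟩ := hK
  obtain ⟨N, hN0, hN⟩ := hL
  refine ⟨2 * M + 2 * N, by positivity, fun y t => ?_⟩
  have h1 := hM y t
  have h2 := hN y t
  have h3 : ‖K y t + L y t‖ ^ 2 ≤ (‖K y t‖ + ‖L y t‖) ^ 2 := by gcongr; exact norm_add_le _ _
  have h4 : ‖(K + L) y t‖ = ‖K y t + L y t‖ := rfl
  rw [h4]
  nlinarith [sq_nonneg (‖K y t‖ - ‖L y t‖)]

theorem abs_integral_abs_sub_pow (τ t : ℝ) (n : ℕ) :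
    |∫ s in τ..t, |s - τ| ^ n| = |t - τ| ^ (n + 1) / (n + 1) := by
  have key : ∀ {a : ℝ}, 0 ≤ a → ∫ s in (0 : ℝ)..a, |s| ^ n = a ^ (n + 1) / (n + 1) := by
    intro a ha
    rw [intervalIntegral.integral_congr (g := fun s => s ^ n), integral_pow]
    · simp
    · intro s hs
      rw [Set.uIcc_of_le ha] at hs
      simp [abs_of_nonneg hs.1]
  rw [intervalIntegral.integral_comp_sub_right (fun s => |s| ^ n), sub_self]
  rcases le_total τ t with h | h
  · rw [key (sub_nonneg.2 h), abs_of_nonneg (sub_nonneg.2 h), abs_of_nonneg]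
    have := sub_nonneg.2 h
    positivity
  · have h' : 0 ≤ τ - t := sub_nonneg.2 h
    have : ∫ s in (0 : ℝ)..(t - τ), |s| ^ n = -((τ - t) ^ (n + 1) / (n + 1)) := by
      rw [← key h', intervalIntegral.integral_symm]
      congr 1
      have := intervalIntegral.integral_comp_neg (a := 0) (b := τ - t) (fun s : ℝ => |s| ^ n)
      simp only [abs_neg, neg_zero, neg_sub] at this
      exact this.symm
    rw [this, abs_neg, abs_sub_comm, abs_of_nonneg h', abs_of_nonneg (by positivity)]

/-- Iterating the defining inequality integrates |s - τ|^n once more at each step. Squares are used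
because a control in L² only allows Cauchy-Schwarz, and absolute values because t may precede τ, as
it does for the adjoint equation. -/
theorem IsVolterra.norm_pow_apply_sq_le {hT : 0 ≤ T} {τ : Set.Icc 0 T}
    {K : C(Set.Icc 0 T, X) →L[ℝ] C(Set.Icc 0 T, X)} {N : ℝ} (hN0 : 0 ≤ N)
    (hN : ∀ y t, ‖K y t‖ ^ 2 ≤ N * |∫ s in (τ : ℝ)..t, ‖Set.IccExtend hT y s‖ ^ 2|) (n : ℕ)
    (y : C(Set.Icc 0 T, X)) (t : Set.Icc 0 T) :
    ‖(K ^ n) y t‖ ^ 2 ≤ ‖y‖ ^ 2 * N ^ n * (|(t : ℝ) - τ| ^ n / n.factorial) := by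
  induction n generalizing t with
  | zero =>
    simp only [pow_zero, one_apply_eq_self, mul_one, Nat.factorial_zero, Nat.cast_one,
      div_one]
    gcongr
    exact y.norm_coe_le_norm t
  | succ n ih =>
    rw [pow_succ' K, mul_apply_eq_comp]
    refine (hN _ t).trans ?_
    have h1 : |∫ s in (τ : ℝ)..t, ‖Set.IccExtend hT ((K ^ n) y) s‖ ^ 2| ≤
        |∫ s in (τ : ℝ)..t, ‖y‖ ^ 2 * N ^ n / n.factorial * |s - τ| ^ n| := by
      rw [← Real.norm_eq_abs]
      refine intervalIntegral.norm_integral_le_abs_of_norm_le ?_ ?_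
      · refine (ae_restrict_iff' measurableSet_uIoc).2 (.of_forall fun s hs => ?_)
        have hs' := Set.uIcc_subset_Icc τ.2 t.2 (Set.uIoc_subset_uIcc hs)
        rw [Set.IccExtend_of_mem hT _ hs', Real.norm_eq_abs, abs_of_nonneg (by positivity)]
        refine (ih ⟨s, hs'⟩).trans_eq ?_
        ring
      · exact (by fun_prop : Continuous fun s : ℝ =>
          ‖y‖ ^ 2 * N ^ n / n.factorial * |s - τ| ^ n).intervalIntegrable _ _
    rw [intervalIntegral.integral_const_mul, abs_mul, abs_integral_abs_sub_pow,
      abs_of_nonneg (show 0 ≤ ‖y‖ ^ 2 * N ^ n / n.factorial by positivity)] at h1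
    calc _ ≤ N * (‖y‖ ^ 2 * N ^ n / n.factorial * (|(t : ℝ) - τ| ^ (n + 1) / (n + 1))) := by gcongr
      _ = _ := by
        rw [Nat.factorial_succ]
        push_cast
        field_simp
        ring

/-- The factorial makes some power K^n a contraction, whatever the size of `N` and `T`. Then 1 - K^n
is invertible, and 1 - K is one of its two commuting factors. -/
theorem IsVolterra.isUnit_one_sub [CompleteSpace X] {hT : 0 ≤ T} {τ : Set.Icc 0 T}
    {K : C(Set.Icc 0 T, X) →L[ℝ] C(Set.Icc 0 T, X)} (hK : IsVolterra hT τ K) :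
    IsUnit (1 - K) := by
  obtain ⟨N, hN0, hN⟩ := hK
  -- The estimate concerns squares: 1/4 here gives ‖K^n‖ ≤ 1/2.
  obtain ⟨n, hn⟩ : ∃ n : ℕ, (N * T) ^ n / n.factorial < 1 / 4 :=
    ((FloorSemiring.tendsto_pow_div_factorial_atTop (N * T)).eventually_lt_const
      (by norm_num : (0 : ℝ) < 1 / 4)).exists
  have hnorm : ‖K ^ n‖ < 1 := by
    refine lt_of_le_of_lt (ContinuousLinearMap.opNorm_le_bound _ (by norm_num : (0 : ℝ) ≤ 1 / 2)
      fun y => ?_) (by norm_num)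
    rw [ContinuousMap.norm_le _ (by positivity)]
    intro t
    refine le_of_sq_le_sq ?_ (by positivity)
    refine (IsVolterra.norm_pow_apply_sq_le hN0 hN n y t).trans ?_
    have ht : |(t : ℝ) - τ| ≤ T := by
      rw [abs_le]; constructor <;> linarith [t.2.1, t.2.2, τ.2.1, τ.2.2]
    calc _ ≤ ‖y‖ ^ 2 * N ^ n * (T ^ n / n.factorial) := by gcongr
      _ = ‖y‖ ^ 2 * ((N * T) ^ n / n.factorial) := by rw [mul_pow]; ring
      _ ≤ ‖y‖ ^ 2 * (1 / 4) := by gcongr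
      _ = _ := by ring
  have hu : IsUnit (1 - K ^ n) := (isUnit_one_sub_of_norm_lt_one (x := K ^ n) hnorm :)
  have hc : Commute (1 - K) (∑ i ∈ Finset.range n, K ^ i) := by
    rw [Commute, SemiconjBy, mul_neg_geom_sum, geom_sum_mul_neg]
  rw [← mul_neg_geom_sum, hc.isUnit_mul_iff] at hu
  exact hu.1

end Volterra

/-! ### Bilinear control systems: solution operator and its derivative in the control -/

noncomputable section ControlSystems

variable {X : Type*} [NormedAddCommGroup X] [NormedSpace ℝ X] {T : ℝ}

/-- Inversion has derivative x ↦ -u⁻¹xu⁻¹ at u, and 1 - (P + Lε) has derivative -L; the two signs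
cancel. -/
theorem exists_hasFDerivAt_inverse_one_sub {H Z : Type*} [NormedAddCommGroup H] [NormedSpace ℝ H]
    [NormedAddCommGroup Z] [NormedSpace ℝ Z] [CompleteSpace Z] (P : Z →L[ℝ] Z)
    (L : H →L[ℝ] Z →L[ℝ] Z) (ε : H) (hu : IsUnit (1 - (P + L ε))) :
    ∃ D : H →L[ℝ] Z →L[ℝ] Z,
      (∀ h z, D h z = Ring.inverse (1 - (P + L ε)) (L h (Ring.inverse (1 - (P + L ε)) z))) ∧
      HasFDerivAt (fun ε => Ring.inverse (1 - (P + L ε))) D ε := by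
  obtain ⟨u, hu⟩ := hu
  have h1 : HasFDerivAt (fun ε => 1 - (P + L ε)) (-L) ε := (L.hasFDerivAt.const_add P).const_sub 1
  have h2 := hasFDerivAt_ringInverse (𝕜 := ℝ) u
  rw [hu] at h2
  have h3 := HasFDerivAt.comp ε h2 h1
  refine ⟨_, fun h z => ?_, h3⟩
  simp [← hu]

theorem BddFamily.continuousOn_IccExtend {q : ℝ → X →L[ℝ] X} {C : ℝ} (hq : BddFamily q C)
    (hT : 0 ≤ T) (y : C(Set.Icc 0 T, X)) (S : Set ℝ) :
    ContinuousOn (fun s => q s (Set.IccExtend hT y s)) S :=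
  (hq.continuous_apply y.continuous.Icc_extend').continuousOn

omit [NormedSpace ℝ X] in
theorem norm_IccExtend_le (hT : 0 ≤ T) (y : C(Set.Icc 0 T, X)) (s : ℝ) :
    ‖Set.IccExtend hT y s‖ ≤ ‖y‖ :=
  y.norm_coe_le_norm _

theorem L2T.continuous_primitive (hT : 0 ≤ T) (h : L2T T) {f : ℝ → X}
    (hf : ContinuousOn f (Set.Icc 0 T)) (τ : Set.Icc 0 T) :
    Continuous fun t : Set.Icc 0 T => ∫ s in (τ : ℝ)..t, h s • f s := by
  have h1 := intervalIntegral.continuousOn_primitive_interval' (b₁ := 0) (b₂ := T)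
    (h.intervalIntegrable_smul hf (Set.left_mem_Icc.2 hT) (Set.right_mem_Icc.2 hT))
    (a := (τ : ℝ)) (by rw [Set.uIcc_of_le hT]; exact τ.2)
  rw [Set.uIcc_of_le hT] at h1
  exact h1.comp_continuous continuous_subtype_val fun t => t.2

/-- Controls are classes on the open interval, whereas interval integrals may see its endpoints;
these are negligible. -/
theorem intervalIntegral_congr_of_ae_Ioo {f g : ℝ → X}
    (hfg : ∀ᵐ s ∂(volume.restrict (Set.Ioo 0 T)), f s = g s) {s t : ℝ} (hs : s ∈ Set.Icc 0 T)
    (ht : t ∈ Set.Icc 0 T) : ∫ r in s..t, f r = ∫ r in s..t, g r := by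
  refine intervalIntegral.integral_congr_ae ?_
  have h0 : ∀ᵐ r : ℝ, r ≠ 0 := by simp [ae_iff, measure_singleton]
  have hT' : ∀ᵐ r : ℝ, r ≠ T := by simp [ae_iff, measure_singleton]
  filter_upwards [(ae_restrict_iff' measurableSet_Ioo).1 hfg, h0, hT'] with r hr hr0 hrT hrt
  have hr' := Set.uIcc_subset_Icc hs ht (Set.uIoc_subset_uIcc hrt)
  exact hr ⟨lt_of_le_of_ne hr'.1 hr0.symm, lt_of_le_of_ne hr'.2 hrT⟩

/-- The function `t ↦ ∫_τ^t h(s) q(s) y(s) ds`. -/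
def volterraFun (hT : 0 ≤ T) {q : ℝ → X →L[ℝ] X} {C : ℝ} (hq : BddFamily q C)
    (τ : Set.Icc 0 T) (h : L2T T) (y : C(Set.Icc 0 T, X)) : C(Set.Icc 0 T, X) :=
  ⟨fun t => ∫ s in (τ : ℝ)..t, h s • q s (Set.IccExtend hT y s),
    h.continuous_primitive hT (hq.continuousOn_IccExtend hT y _) τ⟩

theorem volterraFun_apply (hT : 0 ≤ T) {q : ℝ → X →L[ℝ] X} {C : ℝ}
    (hq : BddFamily q C) (τ : Set.Icc 0 T) (h : L2T T) (y : C(Set.Icc 0 T, X))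
    (t : Set.Icc 0 T) :
    volterraFun hT hq τ h y t = ∫ s in (τ : ℝ)..t, h s • q s (Set.IccExtend hT y s) := rfl

/-- The Volterra operator `(h, y) ↦ ∫_τ^t h(s) q(s) y(s) ds`. -/
def volterra (hT : 0 ≤ T) {q : ℝ → X →L[ℝ] X} {C : ℝ} (hq : BddFamily q C)
    (τ : Set.Icc 0 T) :
    L2T T →L[ℝ] C(Set.Icc 0 T, X) →L[ℝ] C(Set.Icc 0 T, X) :=
  LinearMap.mkContinuous₂
    (LinearMap.mk₂ ℝ (volterraFun hT hq τ)
      (fun h₁ h₂ y => by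
        ext t
        rw [ContinuousMap.add_apply, volterraFun_apply, volterraFun_apply, volterraFun_apply,
          ← intervalIntegral.integral_add
          (h₁.intervalIntegrable_smul (hq.continuousOn_IccExtend hT y _) τ.2 t.2)
          (h₂.intervalIntegrable_smul (hq.continuousOn_IccExtend hT y _) τ.2 t.2)]
        refine intervalIntegral_congr_of_ae_Ioo ?_ τ.2 t.2
        filter_upwards [Lp.coeFn_add h₁ h₂] with s hs
        rw [hs, Pi.add_apply, add_smul])
      (fun c h y => by
        ext t
        rw [ContinuousMap.smul_apply, volterraFun_apply, volterraFun_apply,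
          ← intervalIntegral.integral_smul]
        refine intervalIntegral_congr_of_ae_Ioo ?_ τ.2 t.2
        filter_upwards [Lp.coeFn_smul c h] with s hs
        rw [hs, Pi.smul_apply, smul_assoc])
      (fun h y₁ y₂ => by
        ext t
        rw [ContinuousMap.add_apply, volterraFun_apply, volterraFun_apply, volterraFun_apply,
          ← intervalIntegral.integral_add
          (h.intervalIntegrable_smul (hq.continuousOn_IccExtend hT y₁ _) τ.2 t.2)
          (h.intervalIntegrable_smul (hq.continuousOn_IccExtend hT y₂ _) τ.2 t.2)]
        simp [Set.IccExtend])
      (fun c h y => by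
        ext t
        rw [ContinuousMap.smul_apply, volterraFun_apply, volterraFun_apply,
          ← intervalIntegral.integral_smul]
        simp [Set.IccExtend, smul_comm c]))
    (√T * C) (fun h y => by
      have hC := hq.nonneg
      rw [ContinuousMap.norm_le _ (by positivity)]
      intro t
      rw [LinearMap.mk₂_apply, volterraFun_apply]
      refine (h.norm_integral_smul_le (hq.continuousOn_IccExtend hT y _) (M := C * ‖y‖)
        (fun s _ => ?_) τ.2 t.2).trans_eq (by ring)
      exact (hq.norm_apply_le s _).trans (by gcongr; exact norm_IccExtend_le hT y s))

theorem volterra_apply (hT : 0 ≤ T) {q : ℝ → X →L[ℝ] X} {C : ℝ}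
    (hq : BddFamily q C) (τ : Set.Icc 0 T) (h : L2T T) (y : C(Set.Icc 0 T, X))
    (t : Set.Icc 0 T) :
    volterra hT hq τ h y t = ∫ s in (τ : ℝ)..t, h s • q s (Set.IccExtend hT y s) := rfl

theorem isVolterra_volterra (hT : 0 ≤ T) {q : ℝ → X →L[ℝ] X} {C : ℝ}
    (hq : BddFamily q C) (τ : Set.Icc 0 T) (h : L2T T) :
    IsVolterra hT τ (volterra hT hq τ h) := by
  refine ⟨‖h‖ ^ 2 * C ^ 2, by positivity, fun y t => ?_⟩
  rw [volterra_apply, mul_assoc]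
  refine (h.norm_integral_smul_sq_le (hq.continuousOn_IccExtend hT y _) τ.2 t.2).trans ?_
  gcongr
  rw [← abs_of_nonneg (sq_nonneg C), ← abs_mul, ← intervalIntegral.integral_const_mul,
    ← Real.norm_eq_abs (∫ r in (τ : ℝ)..t, _)]
  refine intervalIntegral.norm_integral_le_abs_of_norm_le (.of_forall fun s => ?_) ?_
  · rw [Real.norm_eq_abs, abs_of_nonneg (by positivity), ← mul_pow]
    gcongr
    exact hq.norm_apply_le s _
  · have hc : Continuous (Set.IccExtend hT y) := y.continuous.Icc_extend'
    exact ((hc.norm.pow 2).const_mul _).intervalIntegrable _ _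

/-- A bilinear control system `y' = p y + ε q y` on `[0,T]`. -/
structure ControlSystem (X : Type*) [NormedAddCommGroup X] [NormedSpace ℝ X] (T : ℝ) where
  nonneg : 0 ≤ T
  p : ℝ → X →L[ℝ] X
  q : ℝ → X →L[ℝ] X
  Cp : ℝ
  Cq : ℝ
  hp : BddFamily p Cp
  hq : BddFamily q Cq

namespace ControlSystem

/-- Extension of a continuous function on `[0,T]` by constants. -/
abbrev ext {X : Type*} [NormedAddCommGroup X] [NormedSpace ℝ X] {T : ℝ} (S : ControlSystem X T)
    (y : C(Set.Icc 0 T, X)) : ℝ → X :=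
  Set.IccExtend S.nonneg y

variable (S : ControlSystem X T) (τ : Set.Icc 0 T)

theorem ext_apply (y : C(Set.Icc 0 T, X)) {t : ℝ} (ht : t ∈ Set.Icc 0 T) :
    S.ext y t = y ⟨t, ht⟩ :=
  Set.IccExtend_of_mem S.nonneg _ ht

theorem continuous_ext (y : C(Set.Icc 0 T, X)) : Continuous (S.ext y) :=
  y.continuous.Icc_extend'

/-- The integral operator of the system, `y ↦ ∫_τ^t (p + ε q) y`. -/
def gen (ε : L2T T) : C(Set.Icc 0 T, X) →L[ℝ] C(Set.Icc 0 T, X) :=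
  volterra S.nonneg S.hp τ (Lp.const 2 _ (1 : ℝ)) + volterra S.nonneg S.hq τ ε

theorem gen_apply (ε : L2T T) (y : C(Set.Icc 0 T, X)) (t : Set.Icc 0 T) :
    S.gen τ ε y t = ∫ s in (τ : ℝ)..t, (S.p s (S.ext y s) + ε s • S.q s (S.ext y s)) := by
  -- The drift p is treated as a control term with constant control 1, so one estimate serves p and
  -- q.
  have h1 : volterra S.nonneg S.hp τ (Lp.const 2 _ (1 : ℝ)) y t =
      ∫ s in (τ : ℝ)..t, S.p s (S.ext y s) := by
    rw [volterra_apply]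
    refine intervalIntegral_congr_of_ae_Ioo ?_ τ.2 t.2
    filter_upwards [Lp.coeFn_const (p := 2) (μ := volume.restrict (Set.Ioo (0 : ℝ) T)) (1 : ℝ)]
      with s hs
    rw [hs, Function.const_apply, one_smul]
  rw [intervalIntegral.integral_add, ← h1]
  · rfl
  · exact (S.hp.continuous_apply (S.continuous_ext y)).intervalIntegrable _ _
  · exact ε.intervalIntegrable_smul (S.hq.continuousOn_IccExtend S.nonneg y _) τ.2 t.2

variable [CompleteSpace X]

theorem isUnit_one_sub_gen (ε : L2T T) : IsUnit (1 - S.gen τ ε) :=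
  ((isVolterra_volterra _ _ _ _).add (isVolterra_volterra _ _ _ _)).isUnit_one_sub

/-- The solution operator `f ↦ y` of `y = f + ∫_τ^t (p + ε q) y`. -/
def sol (ε : L2T T) : C(Set.Icc 0 T, X) →L[ℝ] C(Set.Icc 0 T, X) :=
  Ring.inverse (1 - S.gen τ ε)

theorem sol_eq_iff (ε : L2T T) (f y : C(Set.Icc 0 T, X)) :
    y = S.sol τ ε f ↔ y = f + S.gen τ ε y := by
  have hu := S.isUnit_one_sub_gen τ ε
  constructor
  · rintro rfl
    have := DFunLike.congr_fun (Ring.mul_inverse_cancel _ hu) f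
    rw [mul_apply_eq_comp, sub_apply, one_apply_eq_self, one_apply_eq_self] at this
    exact sub_eq_iff_eq_add.1 this
  · intro h
    have h' : f = (1 - S.gen τ ε) y := by
      rw [sub_apply, one_apply_eq_self, eq_sub_iff_add_eq]
      exact h.symm
    have := DFunLike.congr_fun (Ring.inverse_mul_cancel _ hu) y
    rw [mul_apply_eq_comp, ← h', one_apply_eq_self] at this
    exact this.symm

/-- The derivative of y in direction h solves the same equation with source ∫ h q y; this is the
linearized equation. -/
theorem hasFDerivAt_sol (ε : L2T T) :
    ∃ D : L2T T →L[ℝ] C(Set.Icc 0 T, X) →L[ℝ] C(Set.Icc 0 T, X),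
      (∀ h f, D h f = S.sol τ ε (volterra S.nonneg S.hq τ h (S.sol τ ε f))) ∧
      HasFDerivAt (S.sol τ) D ε :=
  exists_hasFDerivAt_inverse_one_sub (volterra S.nonneg S.hp τ (Lp.const 2 _ (1 : ℝ)))
    (volterra S.nonneg S.hq τ) ε (S.isUnit_one_sub_gen τ ε)

end ControlSystem

end ControlSystems

/-! ### Skew-adjoint systems: duality, energy estimate, observation -/

noncomputable section SkewControlSystems

namespace ControlSystem

variable {X : Type*} [NormedAddCommGroup X] [InnerProductSpace ℝ X] [CompleteSpace X] {T : ℝ}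

local notation "⟪" x ", " y "⟫" => inner ℝ x y

/-- The operators of the system are skew-adjoint. -/
structure IsSkew (S : ControlSystem X T) : Prop where
  p : ∀ s x y, ⟪S.p s x, y⟫ = -⟪x, S.p s y⟫
  q : ∀ s x y, ⟪S.q s x, y⟫ = -⟪x, S.q s y⟫

/-- `y` solves `y' = (p + ε q) y + h f`. -/
def IsTraj (S : ControlSystem X T) (ε h : L2T T) (f : ℝ → X) (y : C(Set.Icc 0 T, X)) : Prop :=
  ∀ a b : Set.Icc 0 T, y b = y a + ∫ s in (a : ℝ)..b,
    (S.p s (S.ext y s) + ε s • S.q s (S.ext y s) + h s • f s)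

variable (S : ControlSystem X T)

omit [CompleteSpace X] in
theorem intervalIntegrable_gen (ε : L2T T) (y : C(Set.Icc 0 T, X)) (a b : Set.Icc 0 T) :
    IntervalIntegrable (fun s => S.p s (S.ext y s) + ε s • S.q s (S.ext y s)) volume a b :=
  ((S.hp.continuous_apply (S.continuous_ext y)).intervalIntegrable _ _).add
    (ε.intervalIntegrable_smul (S.hq.continuousOn_IccExtend S.nonneg y _) a.2 b.2)

-- Removes the base point: trajectories integrated from 0 and from T take the same form on every [a,
-- b], so that they can be paired.
omit [CompleteSpace X] in
theorem isTraj_of_eq {ε h : L2T T} {τ : Set.Icc 0 T} {c : X} {w y : C(Set.Icc 0 T, X)}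
    (hy : y = ContinuousMap.const _ c + volterra S.nonneg S.hq τ h w + S.gen τ ε y) :
    S.IsTraj ε h (fun s => S.q s (S.ext w s)) y ∧ y τ = c := by
  have i1 := fun a b => S.intervalIntegrable_gen ε y a b
  have i2 := fun a b : Set.Icc 0 T =>
    h.intervalIntegrable_smul (S.hq.continuousOn_IccExtend S.nonneg w (Set.Icc 0 T)) a.2 b.2
  have key : ∀ t, y t = c + ∫ s in (τ : ℝ)..t,
      (S.p s (S.ext y s) + ε s • S.q s (S.ext y s) + h s • S.q s (S.ext w s)) := by
    intro t
    conv_lhs => rw [hy]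
    rw [ContinuousMap.add_apply, ContinuousMap.add_apply, ContinuousMap.const_apply,
      volterra_apply, gen_apply, intervalIntegral.integral_add (i1 τ t) (i2 τ t)]
    abel
  refine ⟨fun a b => ?_, by simpa using key τ⟩
  rw [key a, key b, add_assoc, intervalIntegral.integral_add_adjacent_intervals
    ((i1 _ _).add (i2 _ _)) ((i1 _ _).add (i2 _ _))]

variable {S}

/-- In the derivative of the pairing the contributions of p and εq cancel by skew-adjointness, and
only the sources remain. With y = z this is the energy identity; with an adjoint and a linearized
trajectory it is the adjoint formula. -/
theorem IsTraj.inner_eq (hS : S.IsSkew) {ε h k : L2T T} {f g : ℝ → X}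
    (hf : ContinuousOn f (Set.Icc 0 T)) (hg : ContinuousOn g (Set.Icc 0 T))
    {y z : C(Set.Icc 0 T, X)} (hy : S.IsTraj ε h f y) (hz : S.IsTraj ε k g z)
    (a b : Set.Icc 0 T) :
    ⟪y b, z b⟫ = ⟪y a, z a⟫ + ∫ s in (a : ℝ)..b,
      (h s * ⟪f s, S.ext z s⟫ + k s * ⟪S.ext y s, g s⟫) := by
  have hsub : Set.uIcc (a : ℝ) b ⊆ Set.Icc 0 T := Set.uIcc_subset_Icc a.2 b.2
  have ext' : ∀ {ε h : L2T T} {f : ℝ → X} {y : C(Set.Icc 0 T, X)}, S.IsTraj ε h f y →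
      ∀ t ∈ Set.uIcc (a : ℝ) b, S.ext y t = S.ext y a + ∫ s in (a : ℝ)..t,
        (S.p s (S.ext y s) + ε s • S.q s (S.ext y s) + h s • f s) := by
    intro ε h f y hy t ht
    rw [S.ext_apply y (hsub ht), S.ext_apply y a.2]
    exact hy a ⟨t, hsub ht⟩
  have := (bilin_primitive (innerSL ℝ)
    ((S.intervalIntegrable_gen ε y a b).add (h.intervalIntegrable_smul hf a.2 b.2))
    ((S.intervalIntegrable_gen ε z a b).add (k.intervalIntegrable_smul hg a.2 b.2))
    (ext' hy) (ext' hz)).2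
  rw [S.ext_apply y a.2, S.ext_apply z a.2, S.ext_apply y b.2, S.ext_apply z b.2] at this
  refine Eq.trans this (congrArg (⟪y a, z a⟫ + ·) ?_)
  refine intervalIntegral.integral_congr fun s _ => ?_
  change ⟪_ + _ • _ + _ • _, _⟫ + ⟪_, _ + _ • _ + _ • _⟫ = _
  simp only [inner_add_left, inner_add_right, real_inner_smul_left, real_inner_smul_right,
    hS.p, hS.q]
  ring

/-- The energy identity gives ‖y(t)‖² = ‖y(τ)‖² + 2∫h⟪f, y⟫. Bounding one factor of each term by the
sup norm ‖y‖, taking the supremum over t and dividing by ‖y‖ gives the estimate; the 2 is that of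
the identity. Neither p nor ε enters the bound. -/
theorem IsTraj.norm_le (hS : S.IsSkew) {ε h : L2T T} {f : ℝ → X}
    (hf : ContinuousOn f (Set.Icc 0 T)) {M : ℝ} (hM : ∀ s ∈ Set.Icc 0 T, ‖f s‖ ≤ M)
    {y : C(Set.Icc 0 T, X)} (hy : S.IsTraj ε h f y) (τ : Set.Icc 0 T) :
    ‖y‖ ≤ ‖y τ‖ + 2 * (√T * ‖h‖ * M) := by
  have hM0 : 0 ≤ M := (norm_nonneg _).trans (hM τ τ.2)
  rcases (norm_nonneg y).eq_or_lt with h0 | h0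
  · rw [← h0]; positivity
  have key : ∀ t, ‖y t‖ ^ 2 ≤ ‖y‖ * (‖y τ‖ + 2 * (√T * ‖h‖ * M)) := by
    intro t
    have e := hy.inner_eq hS hf hf hy τ t
    rw [real_inner_self_eq_norm_sq, real_inner_self_eq_norm_sq] at e
    have hg : ContinuousOn (fun s => ⟪f s, S.ext y s⟫) (Set.Icc 0 T) :=
      hf.inner (S.continuous_ext y).continuousOn
    have e2 : ∫ s in (τ : ℝ)..t, (h s * ⟪f s, S.ext y s⟫ + h s * ⟪S.ext y s, f s⟫) =
        2 * ∫ s in (τ : ℝ)..t, h s • ⟪f s, S.ext y s⟫ := by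
      rw [← intervalIntegral.integral_const_mul]
      refine intervalIntegral.integral_congr fun s _ => ?_
      simp only [real_inner_comm (f s), smul_eq_mul]
      ring
    have b := h.norm_integral_smul_le hg (M := M * ‖y‖) (fun s hs => by
      refine (norm_inner_le_norm _ _).trans ?_
      gcongr
      · exact hM s hs
      · exact norm_IccExtend_le S.nonneg y s) τ.2 t.2
    have b' := (le_abs_self _).trans b
    have h1 : ‖y τ‖ ^ 2 ≤ ‖y‖ * ‖y τ‖ := by
      rw [pow_two]; gcongr; exact y.norm_coe_le_norm τ
    rw [e, e2]
    calc _ ≤ ‖y‖ * ‖y τ‖ + 2 * (√T * ‖h‖ * (M * ‖y‖)) := by gcongr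
      _ = _ := by ring
  have key2 : ‖y‖ ≤ √(‖y‖ * (‖y τ‖ + 2 * (√T * ‖h‖ * M))) := by
    rw [ContinuousMap.norm_le _ (Real.sqrt_nonneg _)]
    exact fun t => Real.le_sqrt_of_sq_le (key t)
  rw [Real.le_sqrt (norm_nonneg _) (by positivity), pow_two] at key2
  exact le_of_mul_le_mul_left key2 h0

variable (S)

/-- The curve `t ↦ -⟪y(t), q(t) z(t)⟫`. -/
def observe (y z : C(Set.Icc 0 T, X)) (t : ℝ) : ℝ := -⟪S.ext y t, S.q t (S.ext z t)⟫

omit [CompleteSpace X] in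
theorem abs_observe_le (y z : C(Set.Icc 0 T, X)) (t : ℝ) :
    |S.observe y z t| ≤ S.Cq * ‖y‖ * ‖z‖ := by
  have h0 := S.hq.nonneg
  rw [observe, abs_neg]
  refine (abs_real_inner_le_norm _ _).trans ?_
  calc _ ≤ ‖y‖ * (S.Cq * ‖z‖) := by
        gcongr
        · exact norm_IccExtend_le S.nonneg y t
        · exact (S.hq.norm_apply_le t _).trans (by gcongr; exact norm_IccExtend_le S.nonneg z t)
    _ = _ := by ring

omit [CompleteSpace X] in
theorem continuous_observe (y z : C(Set.Icc 0 T, X)) : Continuous (S.observe y z) :=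
  ((S.continuous_ext y).inner (S.hq.continuous_apply (S.continuous_ext z))).neg

omit [CompleteSpace X] in
theorem memLp_observe (y z : C(Set.Icc 0 T, X)) :
    MemLp (S.observe y z) 2 (volume.restrict (Set.Ioo 0 T)) :=
  MemLp.of_bound (S.continuous_observe y z).aestronglyMeasurable _
    (.of_forall (S.abs_observe_le y z))

/-- `observe` as a bilinear map with values in `L²(0,T)`. -/
def observeL2 : C(Set.Icc 0 T, X) →L[ℝ] C(Set.Icc 0 T, X) →L[ℝ] L2T T :=
  LinearMap.mkContinuous₂
    (LinearMap.mk₂ ℝ (fun y z => (S.memLp_observe y z).toLp)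
      (fun y₁ y₂ z => by
        rw [← MemLp.toLp_add]
        exact MemLp.toLp_congr _ _ (.of_forall fun t => by
          simp [observe, Set.IccExtend, inner_add_left, add_comm]))
      (fun c y z => by
        rw [← MemLp.toLp_const_smul]
        exact MemLp.toLp_congr _ _ (.of_forall fun t => by
          simp [observe, Set.IccExtend, real_inner_smul_left]))
      (fun y z₁ z₂ => by
        rw [← MemLp.toLp_add]
        exact MemLp.toLp_congr _ _ (.of_forall fun t => by
          simp [observe, Set.IccExtend, inner_add_right, add_comm]))
      (fun c y z => by
        rw [← MemLp.toLp_const_smul]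
        exact MemLp.toLp_congr _ _ (.of_forall fun t => by
          simp [observe, Set.IccExtend, real_inner_smul_right])))
    (√T * S.Cq) (fun y z => by
      have h0 := S.hq.nonneg
      rw [LinearMap.mk₂_apply]
      -- The factor √T is the cost of passing from a uniform bound to the norm of L²(0,T).
      refine (Lp.norm_le_of_ae_bound (C := S.Cq * ‖y‖ * ‖z‖) (by positivity) ?_).trans_eq ?_
      · filter_upwards [(S.memLp_observe y z).coeFn_toLp] with t ht
        rw [ht]
        exact S.abs_observe_le y z t
      · have : (measureUnivNNReal (volume.restrict (Set.Ioo 0 T)) : ℝ) = T := by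
          rw [measureUnivNNReal, ENNReal.coe_toNNReal_eq_toReal]
          simp [S.nonneg]
        rw [this]
        simp only [ENNReal.toReal_ofNat, Real.sqrt_eq_rpow]
        ring_nf)

omit [CompleteSpace X] in
theorem coeFn_observeL2 (y z : C(Set.Icc 0 T, X)) :
    S.observeL2 y z =ᵐ[volume.restrict (Set.Ioo 0 T)] S.observe y z :=
  (S.memLp_observe y z).coeFn_toLp

omit [CompleteSpace X] in
theorem norm_observeL2_le (y z : C(Set.Icc 0 T, X)) :
    ‖S.observeL2 y z‖ ≤ √T * S.Cq * ‖y‖ * ‖z‖ := by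
  have h0 := S.hq.nonneg
  exact ContinuousLinearMap.le_of_opNorm₂_le_of_le _
    (LinearMap.mkContinuous₂_norm_le _ (by positivity) _) le_rfl le_rfl

end ControlSystem

end SkewControlSystems

/-! ### Gradient of the cost and derivative of the observed curve -/

noncomputable section SkewControlCost

namespace ControlSystem

variable {X : Type*} [NormedAddCommGroup X] [InnerProductSpace ℝ X] [CompleteSpace X] {T : ℝ}
  (S : ControlSystem X T)

local notation "⟪" x ", " y "⟫" => inner ℝ x y

/-- The initial time. -/
def t0 : Set.Icc (0 : ℝ) T := ⟨0, Set.left_mem_Icc.2 S.nonneg⟩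

/-- The final time. -/
def t1 : Set.Icc (0 : ℝ) T := ⟨T, Set.right_mem_Icc.2 S.nonneg⟩

/-- Constant trajectories. -/
def constL : X →L[ℝ] C(Set.Icc 0 T, X) :=
  LinearMap.mkContinuous
    { toFun := ContinuousMap.const _
      map_add' := fun _ _ => rfl
      map_smul' := fun _ _ => rfl } 1 (fun x => by
      rw [one_mul, ContinuousMap.norm_le _ (norm_nonneg x)]
      exact fun t => le_rfl)

omit [CompleteSpace X] in
theorem constL_apply (x : X) : constL (T := T) x = ContinuousMap.const _ x := rfl

/-- The trajectory starting from `x`. -/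
def fwd (x : X) (ε : L2T T) : C(Set.Icc 0 T, X) := S.sol S.t0 ε (constL x)

/-- The trajectory with value `O y(T)` at time `T`, where `y` is the trajectory starting
from `x`. -/
def bwd (O : X →L[ℝ] X) (x : X) (ε : L2T T) : C(Set.Icc 0 T, X) :=
  S.sol S.t1 ε (constL (O (S.fwd x ε S.t1)))

theorem hasFDerivAt_fwd (x : X) (ε : L2T T) :
    ∃ D : L2T T →L[ℝ] C(Set.Icc 0 T, X),
      (∀ h, D h = S.sol S.t0 ε (volterra S.nonneg S.hq S.t0 h (S.fwd x ε))) ∧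
      HasFDerivAt (S.fwd x) D ε := by
  obtain ⟨D, hD, hD'⟩ := S.hasFDerivAt_sol S.t0 ε
  have h1 := hD'.clm_apply (hasFDerivAt_const (constL (T := T) x) ε)
  refine ⟨_, fun h => ?_, h1⟩
  simp [hD, fwd]

/-- The control acts twice on the adjoint trajectory: through its final value, which depends on the
state, and through the equation itself. Hence the two data in the linearized equation. -/
theorem hasFDerivAt_bwd (O : X →L[ℝ] X) (x : X) (ε : L2T T) {D : L2T T →L[ℝ] C(Set.Icc 0 T, X)}
    (hD : HasFDerivAt (S.fwd x) D ε) :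
    ∃ D' : L2T T →L[ℝ] C(Set.Icc 0 T, X),
      (∀ h, D' h = S.sol S.t1 ε (constL (O (D h S.t1)) +
        volterra S.nonneg S.hq S.t1 h (S.bwd O x ε))) ∧
      HasFDerivAt (S.bwd O x) D' ε := by
  obtain ⟨D₁, hD₁, hD₁'⟩ := S.hasFDerivAt_sol S.t1 ε
  have h0 := ((constL (T := T)).comp (O.comp (ContinuousMap.evalCLM ℝ S.t1))).hasFDerivAt.comp ε hD
  have h1 := hD₁'.clm_apply h0
  refine ⟨_, fun h => ?_, h1⟩
  simp only [ContinuousLinearMap.comp_apply, ContinuousLinearMap.flip_apply, add_apply, hD₁,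
    Function.comp_apply, map_add]
  rfl

theorem isTraj_fwd (x : X) (ε : L2T T) :
    S.IsTraj ε 0 (fun s => S.q s (S.ext 0 s)) (S.fwd x ε) ∧ S.fwd x ε S.t0 = x := by
  have := (S.sol_eq_iff S.t0 ε _ _).1 (rfl : S.fwd x ε = _)
  -- The homogeneous equation is the case of a zero source.
  refine S.isTraj_of_eq (w := 0) (h := 0) ?_
  simpa [constL_apply] using this

theorem isTraj_bwd (O : X →L[ℝ] X) (x : X) (ε : L2T T) :
    S.IsTraj ε 0 (fun s => S.q s (S.ext 0 s)) (S.bwd O x ε) ∧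
      S.bwd O x ε S.t1 = O (S.fwd x ε S.t1) := by
  have := (S.sol_eq_iff S.t1 ε _ _).1 (rfl : S.bwd O x ε = _)
  refine S.isTraj_of_eq (w := 0) (h := 0) ?_
  simpa [constL_apply] using this

variable {S}

omit [CompleteSpace X] in
theorem continuousOn_q_ext (y : C(Set.Icc 0 T, X)) :
    ContinuousOn (fun s => S.q s (S.ext y s)) (Set.Icc 0 T) :=
  S.hq.continuousOn_IccExtend S.nonneg y _

omit [CompleteSpace X] in
theorem norm_q_ext_le (y : C(Set.Icc 0 T, X)) (s : ℝ) : ‖S.q s (S.ext y s)‖ ≤ S.Cq * ‖y‖ := by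
  have := S.hq.nonneg
  exact (S.hq.norm_apply_le s _).trans (by gcongr; exact norm_IccExtend_le S.nonneg y s)

theorem norm_fwd_le (hS : S.IsSkew) (x : X) (ε : L2T T) : ‖S.fwd x ε‖ ≤ ‖x‖ := by
  obtain ⟨h1, h2⟩ := S.isTraj_fwd x ε
  have := h1.norm_le hS (continuousOn_q_ext 0) (fun s _ => norm_q_ext_le 0 s) S.t0
  simpa [h2] using this

theorem norm_bwd_le (hS : S.IsSkew) (O : X →L[ℝ] X) (x : X) (ε : L2T T) :
    ‖S.bwd O x ε‖ ≤ ‖O‖ * ‖x‖ := by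
  obtain ⟨h1, h2⟩ := S.isTraj_bwd O x ε
  have := h1.norm_le hS (continuousOn_q_ext 0) (fun s _ => norm_q_ext_le 0 s) S.t1
  rw [h2, norm_zero, mul_zero, zero_mul, mul_zero, add_zero] at this
  exact this.trans (O.le_opNorm_of_le (((S.fwd x ε).norm_coe_le_norm _).trans (norm_fwd_le hS x ε)))

/-- The adjoint formula for the linearized equation. -/
theorem inner_bwd_deriv_fwd (hS : S.IsSkew) (O : X →L[ℝ] X) (x : X) (ε h : L2T T)
    {δ : C(Set.Icc 0 T, X)}
    (hδ : δ = S.sol S.t0 ε (volterra S.nonneg S.hq S.t0 h (S.fwd x ε))) :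
    ⟪O (S.fwd x ε S.t1), δ S.t1⟫ = -⟪S.observeL2 (S.bwd O x ε) (S.fwd x ε), h⟫ := by
  have e := (S.sol_eq_iff S.t0 ε _ _).1 hδ
  obtain ⟨d1, d2⟩ := S.isTraj_of_eq (τ := S.t0) (ε := ε) (c := 0) (w := S.fwd x ε) (y := δ) (h := h) (by
    conv_lhs => rw [e]
    simp)
  obtain ⟨b1, b2⟩ := S.isTraj_bwd O x ε
  -- The adjoint trajectory has no source and `δ` vanishes at time 0, so the integral of h⟪bwd, q
  -- fwd⟫ is all that remains.
  have key := b1.inner_eq hS (continuousOn_q_ext 0) (continuousOn_q_ext _) d1 S.t0 S.t1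
  rw [b2, d2, inner_zero_right, zero_add] at key
  rw [key, L2.inner_def, ← integral_neg, t0, t1,
    intervalIntegral.integral_of_le S.nonneg, integral_Ioc_eq_integral_Ioo]
  refine integral_congr_ae ?_
  filter_upwards [S.coeFn_observeL2 (S.bwd O x ε) (S.fwd x ε),
    Lp.coeFn_zero ℝ 2 (volume.restrict (Set.Ioo (0 : ℝ) T))] with s hs h0
  rw [hs, h0]
  simp [observe]

/-- The gradient of the cost. -/
theorem hasGradientAt_cost (hS : S.IsSkew) (α : ℝ) {O : X →L[ℝ] X}
    (hO : ∀ x y, ⟪O x, y⟫ = ⟪x, O y⟫) (x : X) (ε : L2T T) :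
    HasGradientAt (fun ε : L2T T => ⟪S.fwd x ε S.t1, O (S.fwd x ε S.t1)⟫ - α * ‖ε‖ ^ 2)
      ((-2 : ℝ) • (α • ε + S.observeL2 (S.bwd O x ε) (S.fwd x ε))) ε := by
  obtain ⟨D, hD, hD'⟩ := S.hasFDerivAt_fwd x ε
  have h1 := (ContinuousMap.evalCLM ℝ S.t1).hasFDerivAt.comp ε hD'
  have h2 := O.hasFDerivAt.comp ε h1
  have h3 := (h1.inner ℝ h2).sub ((hasStrictFDerivAt_norm_sq ε).hasFDerivAt.const_mul α)
  rw [hasGradientAt_iff_hasFDerivAt]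
  refine h3.congr_fderiv ?_
  ext h
  have h4 := inner_bwd_deriv_fwd hS O x ε h (hD h)
  simp only [sub_apply, ContinuousLinearMap.comp_apply,
    InnerProductSpace.toDual_apply_apply, ContinuousLinearMap.prod_apply, fderivInnerCLM_apply,
    Function.comp_apply, ContinuousMap.evalCLM_apply, real_inner_smul_left, inner_add_left,
    smul_apply, innerSL_apply_apply, smul_eq_mul, nsmul_eq_mul,
    Nat.cast_ofNat]
  -- Symmetry of `O` makes the two terms of the derivative of the quadratic form equal, which gives
  -- the factor 2.
  have h5 : ⟪S.fwd x ε S.t1, O (D h S.t1)⟫ = ⟪O (S.fwd x ε S.t1), D h S.t1⟫ := (hO _ _).symm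
  have h6 : ⟪D h S.t1, O (S.fwd x ε S.t1)⟫ = ⟪O (S.fwd x ε S.t1), D h S.t1⟫ := real_inner_comm _ _
  rw [h5, h6, h4]
  ring

/-- Differentiability of the observed curve, with a bound for the derivative. -/
theorem hasFDerivAt_observeL2 (hS : S.IsSkew) (O : X →L[ℝ] X) {x : X} (hx : ‖x‖ = 1)
    (ε : L2T T) :
    ∃ D : L2T T →L[ℝ] L2T T, ‖D‖ ≤ 6 * T * S.Cq ^ 2 * ‖O‖ ∧
      HasFDerivAt (fun ε => S.observeL2 (S.bwd O x ε) (S.fwd x ε)) D ε := by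
  obtain ⟨D, hD, hD'⟩ := S.hasFDerivAt_fwd x ε
  obtain ⟨D₁, hD₁, hD₁'⟩ := S.hasFDerivAt_bwd O x ε hD'
  have hC := S.hq.nonneg
  have hT := S.nonneg
  refine ⟨_, ?_, S.observeL2.hasFDerivAt_of_bilinear hD₁' hD'⟩
  refine ContinuousLinearMap.opNorm_le_bound _ (by positivity) fun h => ?_
  have nf : ‖S.fwd x ε‖ ≤ 1 := hx ▸ norm_fwd_le hS x ε
  have nb : ‖S.bwd O x ε‖ ≤ ‖O‖ := by simpa [hx] using norm_bwd_le hS O x ε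
  have n1 : ‖D h‖ ≤ 2 * (√T * ‖h‖ * S.Cq) := by
    have e := (S.sol_eq_iff S.t0 ε _ _).1 (hD h)
    obtain ⟨d1, d2⟩ := S.isTraj_of_eq (τ := S.t0) (ε := ε) (c := 0) (w := S.fwd x ε) (y := D h) (h := h) (by
      conv_lhs => rw [e]
      simp)
    have := d1.norm_le hS (continuousOn_q_ext _) (fun s _ => norm_q_ext_le _ s) S.t0
    rw [d2, norm_zero, zero_add] at this
    refine this.trans ?_
    calc _ ≤ 2 * (√T * ‖h‖ * (S.Cq * 1)) := by gcongr
      _ = _ := by ring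
  -- Half of the constant 4 comes from the final value O δ(T), bounded through `n1`; the other half
  -- comes from the source h q χ.
  have n2 : ‖D₁ h‖ ≤ 4 * (√T * ‖h‖ * S.Cq) * ‖O‖ := by
    have e := (S.sol_eq_iff S.t1 ε _ _).1 (hD₁ h)
    obtain ⟨d1, d2⟩ := S.isTraj_of_eq (c := O (D h S.t1)) (w := S.bwd O x ε) (y := D₁ h)
      (h := h) e
    have := d1.norm_le hS (continuousOn_q_ext _) (fun s _ => norm_q_ext_le _ s) S.t1
    rw [d2] at this
    refine this.trans ?_
    have := O.le_opNorm_of_le (((D h).norm_coe_le_norm S.t1).trans n1)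
    calc _ ≤ ‖O‖ * (2 * (√T * ‖h‖ * S.Cq)) + 2 * (√T * ‖h‖ * (S.Cq * ‖O‖)) := by gcongr
      _ = _ := by ring
  have n3 : ‖S.observeL2 (S.bwd O x ε) (D h)‖ ≤ √T * S.Cq * ‖O‖ * (2 * (√T * ‖h‖ * S.Cq)) :=
    (S.norm_observeL2_le _ _).trans (by gcongr)
  have n4 : ‖S.observeL2 (D₁ h) (S.fwd x ε)‖ ≤
      √T * S.Cq * (4 * (√T * ‖h‖ * S.Cq) * ‖O‖) * 1 :=
    (S.norm_observeL2_le _ _).trans (by gcongr)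
  -- Here 6 = 2 + 4. One √T comes from the energy estimate and one from the observation.
  refine (norm_add_le _ _).trans ((add_le_add n3 n4).trans_eq ?_)
  have : √T * √T = T := Real.mul_self_sqrt hT
  linear_combination (6 * S.Cq ^ 2 * ‖O‖ * ‖h‖) * this

end ControlSystem

end SkewControlCost

/-! ### Fourier multipliers with bounded continuous symbol on L² -/

noncomputable section FourierMultipliers

open scoped BoundedContinuousFunction FourierTransform

theorem real_inner_L2 (f g : L2) : inner ℝ f g = (inner ℂ f g).re := by
  rw [L2.inner_def, L2.inner_def]
  have := integral_re (𝕜 := ℂ) (L2.integrable_inner (𝕜 := ℂ) f g)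
  rw [show (∫ a, inner ℂ (f a) (g a)).re = RCLike.re (∫ a, inner ℂ (f a) (g a)) from rfl, ← this]
  rfl

theorem bcf_memLp_top (g : E3 →ᵇ ℂ) : MemLp g ∞ (volume : Measure E3) := g.memLp_top

/-- The Fourier multiplier on `L²` with a bounded continuous symbol. -/
def fm : (E3 →ᵇ ℂ) →L[ℂ] L2 →L[ℂ] L2 :=
  LinearMap.mkContinuous₂
    (LinearMap.mk₂ ℂ (fun (g : E3 →ᵇ ℂ) (f : L2) =>
        (Lp.fourierTransformₗᵢ E3 ℂ).symm
          (((bcf_memLp_top g).toLp g • Lp.fourierTransformₗᵢ E3 ℂ f : L2)))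
      (fun g₁ g₂ f => by
        rw [← map_add, ← Lp.smul_add, ← MemLp.toLp_add]
        rfl)
      (fun c g f => by
        rw [← map_smul, ← Lp.smul_assoc, ← MemLp.toLp_const_smul]
        rfl)
      (fun g f₁ f₂ => by rw [map_add, Lp.add_smul, map_add])
      (fun c g f => by rw [map_smul, ← Lp.smul_comm, map_smul]))
    1 (fun g f => by
      rw [LinearMap.mk₂_apply, LinearIsometryEquiv.norm_map, one_mul]
      refine (Lp.norm_smul_le _ _).trans ?_
      rw [LinearIsometryEquiv.norm_map]
      gcongr
      rw [Lp.norm_toLp]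
      refine ENNReal.toReal_le_of_le_ofReal (norm_nonneg g) ?_
      rw [eLpNorm_exponent_top]
      exact eLpNormEssSup_le_of_ae_bound (.of_forall g.norm_coe_le_norm))

theorem fm_apply (g : E3 →ᵇ ℂ) (f : L2) :
    fm g f = 𝓕⁻ ((bcf_memLp_top g).toLp g • 𝓕 f : L2) := rfl

theorem fourier_fm (g : E3 →ᵇ ℂ) (f : L2) :
    𝓕 (fm g f) = ((bcf_memLp_top g).toLp g • 𝓕 f : L2) := by
  rw [fm_apply]
  exact (Lp.fourierTransformₗᵢ E3 ℂ).apply_symm_apply _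

theorem fourier_fm_ae (g : E3 →ᵇ ℂ) (f : L2) :
    (𝓕 (fm g f) : L2) =ᵐ[volume] fun x => g x * (𝓕 f : L2) x := by
  rw [fourier_fm]
  filter_upwards [Lp.coeFn_lpSMul (r := 2) ((bcf_memLp_top g).toLp g) (𝓕 f : L2),
    (bcf_memLp_top g).coeFn_toLp] with x h1 h2
  rw [h1, Pi.smul_apply', h2, smul_eq_mul]

theorem fourier_L2_injective : Function.Injective (fun f : L2 => (𝓕 f : L2)) :=
  (Lp.fourierTransformₗᵢ E3 ℂ).injective

theorem fm_mul (g h : E3 →ᵇ ℂ) (f : L2) : fm (g * h) f = fm g (fm h f) := by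
  apply fourier_L2_injective
  refine Lp.ext ?_
  filter_upwards [fourier_fm_ae (g * h) f, fourier_fm_ae g (fm h f), fourier_fm_ae h f]
    with x h1 h2 h3
  rw [h1, h2, h3, BoundedContinuousFunction.mul_apply, mul_assoc]

theorem fm_comm (g h : E3 →ᵇ ℂ) (f : L2) : fm g (fm h f) = fm h (fm g f) := by
  rw [← fm_mul, mul_comm, fm_mul]

theorem fm_one (f : L2) : fm 1 f = f := by
  apply fourier_L2_injective
  refine Lp.ext ?_
  filter_upwards [fourier_fm_ae 1 f] with x h1
  rw [h1, BoundedContinuousFunction.coe_one, Pi.one_apply, one_mul]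

theorem inner_fm (g : E3 →ᵇ ℂ) (f k : L2) : inner ℂ (fm g f) k = inner ℂ f (fm (star g) k) := by
  rw [← Lp.inner_fourier_eq (fm g f), ← Lp.inner_fourier_eq f, L2.inner_def, L2.inner_def]
  refine integral_congr_ae ?_
  filter_upwards [fourier_fm_ae g f, fourier_fm_ae (star g) k] with x h1 h2
  simp only [h1, h2, RCLike.inner_apply, BoundedContinuousFunction.star_apply, map_mul,
    starRingEnd_apply]
  ring

/-- Identifies the L² multiplier with the distributional one, through which the Laplacian and
Sobolev membership are computed. -/
theorem coe_fm {g : E3 →ᵇ ℂ} (hg : Function.HasTemperateGrowth (g : E3 → ℂ)) (f : L2) :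
    (fm g f : 𝓢'(E3, ℂ)) = TemperedDistribution.fourierMultiplierCLM ℂ g (f : 𝓢'(E3, ℂ)) := by
  rw [TemperedDistribution.fourierMultiplierCLM_apply, Lp.fourier_toTemperedDistribution_eq,
    fm_apply, ← Lp.fourierInv_toTemperedDistribution_eq, Lp.toTemperedDistribution_smul_eq hg]

theorem coe_L2_injective : Function.Injective fun f : L2 => (f : 𝓢'(E3, ℂ)) := by
  have := Lp.ker_toTemperedDistributionCLM_eq_bot (E := E3) (F := ℂ) (μ := volume) (p := 2)
  exact LinearMap.ker_eq_bot.1 this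

end FourierMultipliers

/-! ### The resolvent and the free Schrödinger group -/

noncomputable section FreeEvolution

open scoped BoundedContinuousFunction FourierTransform

/-- The constant `4π²`: with Mathlib's convention `-Δ` has the symbol `4π²‖ξ‖²`. -/
def lapConst : ℝ := (2 * Real.pi) ^ 2

theorem lapConst_pos : 0 < lapConst := by
  have := Real.pi_pos
  unfold lapConst
  positivity

/-- The symbol `(1 + ‖ξ‖²)⁻¹`. -/
def resSymbol : E3 →ᵇ ℂ :=
  BoundedContinuousFunction.ofNormedAddCommGroup (fun ξ => (((1 + ‖ξ‖ ^ 2)⁻¹ : ℝ) : ℂ))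
    (Complex.continuous_ofReal.comp (Continuous.inv₀ (by fun_prop) fun ξ => by positivity)) 1
    (fun ξ => by
      rw [Complex.norm_real, Real.norm_of_nonneg (by positivity)]
      exact inv_le_one_of_one_le₀ (by simp))

theorem resSymbol_apply (ξ : E3) : resSymbol ξ = (((1 + ‖ξ‖ ^ 2)⁻¹ : ℝ) : ℂ) := rfl

/-- The symbol of the free Schrödinger evolution. -/
def evoSymbol (t : ℝ) : E3 →ᵇ ℂ :=
  BoundedContinuousFunction.ofNormedAddCommGroup
    (fun ξ => Complex.exp (((-(t * lapConst * ‖ξ‖ ^ 2) : ℝ) : ℂ) * Complex.I))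
    (by fun_prop) 1 (fun ξ => (Complex.norm_exp_ofReal_mul_I _).le)

theorem evoSymbol_apply (t : ℝ) (ξ : E3) :
    evoSymbol t ξ = Complex.exp (((-(t * lapConst * ‖ξ‖ ^ 2) : ℝ) : ℂ) * Complex.I) := rfl

/-- The resolvent `(1 - (4π²)⁻¹ Δ)⁻¹`. -/
def res : L2 →L[ℂ] L2 := fm resSymbol

/-- The free Schrödinger evolution `exp(i t Δ)`. -/
def evo (t : ℝ) : L2 →L[ℂ] L2 := fm (evoSymbol t)

theorem evo_zero (f : L2) : evo 0 f = f := by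
  have : evoSymbol 0 = 1 := by
    ext ξ
    simp [evoSymbol_apply]
  rw [evo, this, fm_one]

theorem evo_add (s t : ℝ) (f : L2) : evo (s + t) f = evo s (evo t f) := by
  have : evoSymbol (s + t) = evoSymbol s * evoSymbol t := by
    ext ξ
    rw [BoundedContinuousFunction.mul_apply, evoSymbol_apply, evoSymbol_apply, evoSymbol_apply,
      ← Complex.exp_add]
    push_cast
    ring_nf
  rw [evo, this, fm_mul]
  rfl

theorem evo_neg_evo (t : ℝ) (f : L2) : evo (-t) (evo t f) = f := by
  rw [← evo_add, neg_add_cancel, evo_zero]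

theorem evo_evo_neg (t : ℝ) (f : L2) : evo t (evo (-t) f) = f := by
  rw [← evo_add, add_neg_cancel, evo_zero]

theorem star_evoSymbol (t : ℝ) : star (evoSymbol t) = evoSymbol (-t) := by
  ext ξ
  rw [BoundedContinuousFunction.star_apply, evoSymbol_apply, evoSymbol_apply, ← starRingEnd_apply,
    ← Complex.exp_conj, map_mul, Complex.conj_I, Complex.conj_ofReal]
  push_cast
  ring_nf

theorem star_resSymbol : star resSymbol = resSymbol := by
  ext ξ
  rw [BoundedContinuousFunction.star_apply, resSymbol_apply, ← starRingEnd_apply,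
    Complex.conj_ofReal]

theorem inner_evo (t : ℝ) (f g : L2) : inner ℂ (evo t f) g = inner ℂ f (evo (-t) g) := by
  rw [evo, inner_fm, star_evoSymbol]
  rfl

theorem inner_res (f g : L2) : inner ℂ (res f) g = inner ℂ f (res g) := by
  rw [res, inner_fm, star_resSymbol]

theorem norm_evo (t : ℝ) (f : L2) : ‖evo t f‖ = ‖f‖ := by
  rw [@norm_eq_sqrt_re_inner ℂ, inner_evo, evo_neg_evo, ← @norm_eq_sqrt_re_inner ℂ]

theorem norm_evo_le (t : ℝ) : ‖evo t‖ ≤ 1 :=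
  ContinuousLinearMap.opNorm_le_bound _ zero_le_one fun f => by rw [norm_evo, one_mul]

theorem evo_res (t : ℝ) (f : L2) : evo t (res f) = res (evo t f) := fm_comm _ _ _

theorem hasTemperateGrowth_resSymbol : Function.HasTemperateGrowth (resSymbol : E3 → ℂ) := by
  have h : (fun ξ : E3 => (((1 + ‖ξ‖ ^ 2) ^ (-1 : ℝ) : ℝ) : ℂ)).HasTemperateGrowth := by fun_prop
  convert h using 2 with ξ
  rw [resSymbol_apply, Real.rpow_neg_one]

theorem coe_res (f : L2) : (res f : 𝓢'(E3, ℂ)) =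
    TemperedDistribution.besselPotential E3 ℂ (-2) (f : 𝓢'(E3, ℂ)) := by
  rw [res, coe_fm hasTemperateGrowth_resSymbol, TemperedDistribution.besselPotential]
  refine congrArg (fun g => TemperedDistribution.fourierMultiplierCLM ℂ g (f : 𝓢'(E3, ℂ)))
    (funext fun ξ => ?_)
  rw [resSymbol_apply, neg_div, div_self two_ne_zero, Real.rpow_neg_one]

theorem besselPotential_coe_res (f : L2) :
    TemperedDistribution.besselPotential E3 ℂ 2 (res f : 𝓢'(E3, ℂ)) = (f : 𝓢'(E3, ℂ)) := by
  rw [coe_res]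
  simp

/-- The Bessel potential of order -2 is the resolvent. Questions about H² thus become questions
about `w` in L². -/
theorem memH2_iff (f : L2) : MemH2 f ↔ ∃ w, f = res w := by
  constructor
  · rintro ⟨w, hw⟩
    refine ⟨w, coe_L2_injective ?_⟩
    have := (TemperedDistribution.besselPotential_neg_apply_eq_iff 2 (w : 𝓢'(E3, ℂ))
      (f : 𝓢'(E3, ℂ))).2 hw
    simp only [coe_res]
    exact this.symm
  · rintro ⟨w, rfl⟩
    exact ⟨w, besselPotential_coe_res w⟩

theorem memH2_res (w : L2) : MemH2 (res w) := (memH2_iff _).2 ⟨w, rfl⟩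

theorem res_injective : Function.Injective res := by
  intro f g h
  apply coe_L2_injective
  simp only
  rw [← besselPotential_coe_res f, h, besselPotential_coe_res]

/-- On the symbols, ‖ξ‖²(1 + ‖ξ‖²)⁻¹ = 1 - (1 + ‖ξ‖²)⁻¹. -/
theorem lap_res (w : L2) : lap (res w) = (lapConst : ℂ) • (res w - w) := by
  apply coe_L2_injective
  simp only
  rw [← (memH2_res w).laplacian_eq, TemperedDistribution.laplacian_eq_fourierMultiplierCLM, res,
    coe_fm hasTemperateGrowth_resSymbol,
    TemperedDistribution.fourierMultiplierCLM_fourierMultiplierCLM_apply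
      hasTemperateGrowth_resSymbol (by fun_prop)]
  have e : (resSymbol * fun ξ : E3 => Complex.ofReal (‖ξ‖ ^ 2)) = ⇑(1 - resSymbol) := by
    ext ξ
    rw [Pi.mul_apply, BoundedContinuousFunction.sub_apply, BoundedContinuousFunction.coe_one,
      Pi.one_apply, resSymbol_apply]
    have : (1 : ℝ) + ‖ξ‖ ^ 2 ≠ 0 := by positivity
    have h : (1 + ‖ξ‖ ^ 2)⁻¹ * ‖ξ‖ ^ 2 = 1 - (1 + ‖ξ‖ ^ 2)⁻¹ := by field_simp; ring
    exact_mod_cast h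
  have hg : Function.HasTemperateGrowth (⇑(1 - resSymbol) : E3 → ℂ) :=
    (Function.HasTemperateGrowth.const 1).sub hasTemperateGrowth_resSymbol
  rw [e, ← coe_fm hg, ← Lp.toTemperedDistributionCLM_apply, ← Lp.toTemperedDistributionCLM_apply,
    map_sub fm, sub_apply, fm_one, map_smul, map_sub, map_sub]
  rw [show (-(2 * Real.pi) ^ 2 : ℝ) = -lapConst from rfl, neg_smul, ← smul_neg, neg_sub]
  rfl

/-- If x is orthogonal to the range then, `res` being symmetric, ‖res (res x)‖² = ⟨res⁴ x, x⟩ = 0,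
and `res` is injective. -/
theorem dense_range_res_res : Dense (Set.range fun z => res (res z)) := by
  have h : ((res.comp res).range)ᗮ = ⊥ := by
    rw [Submodule.eq_bot_iff]
    intro x hx
    have h1 : inner ℂ (res (res (res (res x)))) x = 0 :=
      (Submodule.mem_orthogonal _ _).1 hx _ ⟨res (res x), rfl⟩
    rw [inner_res, inner_res, inner_self_eq_zero] at h1
    have : res (res x) = res (res 0) := by rw [h1, map_zero, map_zero]
    exact res_injective (res_injective this)
  have h2 := (Submodule.topologicalClosure_eq_top_iff).2 h
  exact (Submodule.dense_iff_topologicalClosure_eq_top).2 h2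

theorem norm_exp_mul_I_sub_one_sub_le (θ : ℝ) :
    ‖Complex.exp (θ * Complex.I) - 1 - θ * Complex.I‖ ≤ 3 * θ ^ 2 := by
  rcases le_total |θ| 1 with h | h
  · refine (Complex.norm_exp_sub_one_sub_id_le (by simpa using h)).trans ?_
    simp only [norm_mul, Complex.norm_real, Complex.norm_I, mul_one, Real.norm_eq_abs, sq_abs]
    nlinarith [sq_nonneg θ]
  · have h1 : ‖Complex.exp (θ * Complex.I) - 1 - θ * Complex.I‖ ≤ 1 + 1 + |θ| := by
      refine (norm_sub_le _ _).trans (add_le_add ((norm_sub_le _ _).trans ?_) ?_)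
      · rw [Complex.norm_exp_ofReal_mul_I, norm_one]
      · simp
    have h2 : |θ| ≤ θ ^ 2 := by rw [← sq_abs]; nlinarith
    linarith

/-- The Taylor remainder of the phase is of order h²‖ξ‖⁴. Two resolvent factors absorb ‖ξ‖⁴, so the
derivative exists uniformly in ξ. -/
theorem hasDerivAt_evoSymbol_mul (t : ℝ) :
    HasDerivAt (fun t => evoSymbol t * (resSymbol * resSymbol))
      ((-(lapConst * Complex.I)) • (evoSymbol t * ((1 - resSymbol) * resSymbol))) t := by
  rw [hasDerivAt_iff_isLittleO_nhds_zero]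
  refine Asymptotics.IsBigO.trans_isLittleO (g := fun h : ℝ => h ^ 2) ?_
    (Asymptotics.isLittleO_pow_id one_lt_two)
  refine Asymptotics.IsBigO.of_bound (3 * lapConst ^ 2) (.of_forall fun h => ?_)
  rw [BoundedContinuousFunction.norm_le (by positivity)]
  intro ξ
  have hne : (1 : ℝ) + ‖ξ‖ ^ 2 ≠ 0 := by positivity
  have hr : (1 : ℂ) - resSymbol ξ = (‖ξ‖ ^ 2 : ℝ) * resSymbol ξ := by
    rw [resSymbol_apply]
    have h : 1 - (1 + ‖ξ‖ ^ 2)⁻¹ = ‖ξ‖ ^ 2 * (1 + ‖ξ‖ ^ 2)⁻¹ := by field_simp; ring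
    exact_mod_cast h
  have he : evoSymbol (t + h) ξ = evoSymbol t ξ *
      Complex.exp (((-(h * lapConst * ‖ξ‖ ^ 2) : ℝ) : ℂ) * Complex.I) := by
    rw [evoSymbol_apply, evoSymbol_apply, ← Complex.exp_add]
    push_cast
    ring_nf
  set θ : ℝ := -(h * lapConst * ‖ξ‖ ^ 2) with hθ
  have e : (evoSymbol (t + h) * (resSymbol * resSymbol) - evoSymbol t * (resSymbol * resSymbol) -
      h • ((-(lapConst * Complex.I)) • (evoSymbol t * ((1 - resSymbol) * resSymbol)))) ξ =
      evoSymbol t ξ * (resSymbol ξ ^ 2 *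
        (Complex.exp ((θ : ℂ) * Complex.I) - 1 - (θ : ℂ) * Complex.I)) := by
    simp only [BoundedContinuousFunction.sub_apply, BoundedContinuousFunction.mul_apply,
      BoundedContinuousFunction.smul_apply, BoundedContinuousFunction.coe_one, Pi.one_apply, hr, he,
      hθ, smul_eq_mul, Complex.real_smul]
    push_cast
    ring
  rw [e, norm_mul, norm_mul, evoSymbol_apply, Complex.norm_exp_ofReal_mul_I, one_mul, norm_pow,
    resSymbol_apply, Complex.norm_real, Real.norm_of_nonneg (by positivity)]
  have h1 := norm_exp_mul_I_sub_one_sub_le θ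
  have h2 : ((1 + ‖ξ‖ ^ 2)⁻¹ * ‖ξ‖ ^ 2) ^ 2 ≤ 1 := by
    refine pow_le_one₀ (by positivity) ?_
    rw [inv_mul_le_one₀ (by positivity)]
    linarith
  calc _ ≤ ((1 + ‖ξ‖ ^ 2)⁻¹) ^ 2 * (3 * θ ^ 2) := by gcongr
    _ = ((1 + ‖ξ‖ ^ 2)⁻¹ * ‖ξ‖ ^ 2) ^ 2 * (3 * lapConst ^ 2 * h ^ 2) := by rw [hθ]; ring
    _ ≤ 1 * (3 * lapConst ^ 2 * h ^ 2) := by gcongr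
    _ = _ := by rw [one_mul, Real.norm_of_nonneg (sq_nonneg h)]

theorem hasDerivAt_evo_res_res (z : L2) (t : ℝ) :
    HasDerivAt (fun t => evo t (res (res z)))
      ((-(lapConst * Complex.I)) • evo t (res z - res (res z))) t := by
  have h1 := ((fm.flip z).restrictScalars ℝ).hasFDerivAt.comp_hasDerivAt t
    (hasDerivAt_evoSymbol_mul t)
  have e1 : (fun t => evo t (res (res z))) =
      fun t => fm (evoSymbol t * (resSymbol * resSymbol)) z := by
    funext s
    rw [fm_mul, fm_mul]
    rfl
  have e2 : (-(lapConst * Complex.I)) • evo t (res z - res (res z)) =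
      fm ((-(lapConst * Complex.I)) • (evoSymbol t * ((1 - resSymbol) * resSymbol))) z := by
    rw [map_smul, smul_apply, fm_mul, fm_mul, map_sub fm, sub_apply, fm_one]
    rfl
  rw [e1, e2]
  exact h1

/-- The group is isometric, so t ↦ `evo t x` is a uniform limit of curves t ↦ `evo t (res (res z))`,
which are differentiable. -/
theorem continuous_evo (x : L2) : Continuous fun t => evo t x := by
  refine continuous_of_uniform_approx_of_continuous fun u hu => ?_
  obtain ⟨δ, hδ, hu⟩ := Metric.mem_uniformity_dist.1 hu
  obtain ⟨y, hz, ⟨z, rfl⟩⟩ := Metric.dense_iff.1 dense_range_res_res x δ hδ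
  refine ⟨fun t => evo t (res (res z)), ?_, fun t => hu ?_⟩
  · exact continuous_iff_continuousAt.2 fun t => (hasDerivAt_evo_res_res z t).continuousAt
  · rw [dist_eq_norm, ← map_sub, norm_evo, ← dist_eq_norm, dist_comm]
    exact hz

end FreeEvolution

/-! ### Multiplication by bounded functions and weak derivatives as distributions -/

noncomputable section Multiplication

open scoped LineDeriv

theorem LInfty.ae_norm_le (m : LInfty) : ∀ᵐ x, ‖m x‖ ≤ ‖m‖ := by
  filter_upwards [ae_le_eLpNormEssSup (f := m) (μ := volume)] with x hx
  rw [← eLpNorm_exponent_top] at hx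
  rw [Lp.norm_def, ← toReal_enorm]
  exact ENNReal.toReal_mono (Lp.eLpNorm_ne_top m) hx

theorem coeFn_mulL2 (m : LInfty) (f : L2) : mulL2 m f =ᵐ[volume] fun x => (m x : ℂ) * f x := by
  filter_upwards [Lp.coeFn_lpSMul (r := 2) m f] with x hx
  rw [mulL2, hx, Pi.smul_apply', Complex.real_smul]

/-- Multiplication by `m ∈ L^∞` as a bounded operator on `L²`. -/
def mulOp (m : LInfty) : L2 →L[ℂ] L2 :=
  LinearMap.mkContinuous
    { toFun := mulL2 m
      map_add' := fun f g => Lp.add_smul m f g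
      map_smul' := fun c f => by
        refine Lp.ext ?_
        filter_upwards [coeFn_mulL2 m (c • f), coeFn_mulL2 m f, Lp.coeFn_smul c f,
          Lp.coeFn_smul c (mulL2 m f)] with x h1 h2 h3 h4
        rw [h1, h3, RingHom.id_apply, h4, Pi.smul_apply, Pi.smul_apply, h2, smul_eq_mul,
          smul_eq_mul]
        ring } ‖m‖ (fun f => Lp.norm_smul_le m f)

theorem mulOp_apply (m : LInfty) (f : L2) : mulOp m f = mulL2 m f := rfl

theorem inner_mulL2 (m : LInfty) (f g : L2) :
    inner ℂ (mulL2 m f) g = inner ℂ f (mulL2 m g) := by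
  rw [L2.inner_def, L2.inner_def]
  refine integral_congr_ae ?_
  filter_upwards [coeFn_mulL2 m f, coeFn_mulL2 m g] with x h1 h2
  simp only [h1, h2, RCLike.inner_apply, map_mul, Complex.conj_ofReal]
  ring

section WeakDerivative

variable {i : Fin 3} {f g : LInfty}

/-- Test functions need not have compact support. -/
theorem HasWeakPartial.integral_eq_of_integrable (h : HasWeakPartial i f g) {ψ : E3 → ℝ}
    (hψ : ContDiff ℝ ∞ ψ) (h1 : Integrable ψ)
    (h2 : Integrable fun x => fderiv ℝ ψ x (EuclideanSpace.single i 1)) :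
    ∫ x, f x * fderiv ℝ ψ x (EuclideanSpace.single i 1) = -∫ x, g x * ψ x := by
  set e : E3 := EuclideanSpace.single i 1 with he
  let η : ContDiffBump (0 : E3) := ⟨1, 2, one_pos, one_lt_two⟩
  have hη : ContDiff ℝ ∞ η := η.contDiff
  have hηc : HasCompactSupport η := η.hasCompactSupport
  -- The test function is cut off by η(c_n x) with c_n → 0. The gradient of the cutoff carries a
  -- factor c_n and disappears in the limit.
  set c : ℕ → ℝ := fun n => 1 / ((n : ℝ) + 1) with hc
  have hcpos : ∀ n, 0 < c n := fun n => by simp only [hc]; positivity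
  have hc1 : ∀ n, c n ≤ 1 := fun n => by
    simp only [hc]
    rw [div_le_one (by positivity)]
    linarith [(Nat.cast_nonneg n : (0 : ℝ) ≤ n)]
  have hc0 : Filter.Tendsto c Filter.atTop (nhds 0) := tendsto_one_div_add_atTop_nhds_zero_nat
  set dη : E3 → ℝ := fun x => fderiv ℝ η x e with hdη
  have hdηc : Continuous dη := (hη.continuous_fderiv (by simp)).clm_apply continuous_const
  obtain ⟨M, hM⟩ : ∃ M, ∀ x, ‖dη x‖ ≤ M :=
    hdηc.bounded_above_of_compact_support (hηc.fderiv_apply (𝕜 := ℝ) e)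
  have hM0 : 0 ≤ M := (norm_nonneg _).trans (hM 0)
  have hfd : ∀ n x, fderiv ℝ (fun y => η (c n • y)) x e = c n * dη (c n • x) := by
    intro n x
    have hd : HasFDerivAt (fun y : E3 => η (c n • y))
        ((fderiv ℝ η (c n • x)).comp (c n • ContinuousLinearMap.id ℝ E3)) x :=
      (hη.differentiable (by simp) _).hasFDerivAt.comp x ((hasFDerivAt_id x).const_smul (c n))
    rw [hd.fderiv]
    simp [hdη]
  have hprod : ∀ n x, fderiv ℝ (fun y => ψ y * η (c n • y)) x e =
      ψ x * (c n * dη (c n • x)) + η (c n • x) * fderiv ℝ ψ x e := by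
    intro n x
    have hd : DifferentiableAt ℝ (fun y : E3 => η (c n • y)) x :=
      ((hη.comp (contDiff_const_smul (c n))).differentiable (by simp)) x
    rw [fderiv_fun_mul (hψ.differentiable (by simp) x) hd]
    simp only [add_apply, smul_apply, smul_eq_mul, hfd]
  have key : ∀ n, ∫ x, f x * (ψ x * (c n * dη (c n • x)) + η (c n • x) * fderiv ℝ ψ x e) =
      -∫ x, g x * (ψ x * η (c n • x)) := by
    intro n
    have := h (fun y => ψ y * η (c n • y)) (hψ.mul (hη.comp (contDiff_const_smul (c n))))
      ((hηc.comp_homeomorph (Homeomorph.smulOfNeZero (c n) (hcpos n).ne')).mul_left)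
    simp only [← he, hprod] at this
    exact this
  have hηx : ∀ x, Filter.Tendsto (fun n => η (c n • x)) Filter.atTop (nhds 1) := by
    intro x
    have h0 : Filter.Tendsto (fun n => c n • x) Filter.atTop (nhds ((0 : ℝ) • x)) :=
      hc0.smul_const x
    rw [zero_smul] at h0
    have := (hη.continuous.tendsto 0).comp h0
    rwa [η.one_of_mem_closedBall (Metric.mem_closedBall_self η.rIn_pos.le)] at this
  have hcm : ∀ n, Continuous fun x : E3 => c n • x := fun n => continuous_const_smul _
  have hηm : ∀ n, Continuous fun x : E3 => η (c n • x) := fun n => hη.continuous.comp (hcm n)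
  have hη1 : ∀ x, |η x| ≤ 1 := fun x => by
    rw [abs_of_nonneg η.nonneg]
    exact η.le_one
  have l1 : Filter.Tendsto (fun n => ∫ x, f x * (ψ x * (c n * dη (c n • x)) +
      η (c n • x) * fderiv ℝ ψ x e)) Filter.atTop (nhds (∫ x, f x * fderiv ℝ ψ x e)) := by
    refine tendsto_integral_of_dominated_convergence
      (fun x => ‖f‖ * (‖ψ x‖ * M + ‖fderiv ℝ ψ x e‖)) (fun n => ?_) ?_ (fun n => ?_) ?_
    · refine (Lp.aestronglyMeasurable f).mul ((h1.aestronglyMeasurable.mul ?_).add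
        ((hηm n).aestronglyMeasurable.mul h2.aestronglyMeasurable))
      exact (continuous_const.mul (hdηc.comp (hcm n))).aestronglyMeasurable
    · exact ((h1.norm.mul_const M).add h2.norm).const_mul _
    · filter_upwards [f.ae_norm_le] with x hx
      rw [norm_mul]
      refine mul_le_mul hx ((norm_add_le _ _).trans (add_le_add ?_ ?_)) (norm_nonneg _)
        (norm_nonneg _)
      · rw [norm_mul, norm_mul, Real.norm_of_nonneg (hcpos n).le]
        gcongr
        calc _ ≤ 1 * M := by gcongr; exacts [hc1 n, hM _]
          _ = M := one_mul M
      · rw [norm_mul]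
        exact mul_le_of_le_one_left (norm_nonneg _) (hη1 _)
    · refine .of_forall fun x => Filter.Tendsto.const_mul _ ?_
      have t1 : Filter.Tendsto (fun n => c n * dη (c n • x)) Filter.atTop (nhds 0) := by
        refine squeeze_zero_norm (a := fun n => c n * M) (fun n => ?_) (by simpa using hc0.mul_const M)
        rw [norm_mul, Real.norm_of_nonneg (hcpos n).le]
        have := hcpos n
        gcongr
        exact hM _
      simpa using (t1.const_mul (ψ x)).add ((hηx x).mul_const (fderiv ℝ ψ x e))
  have l2 : Filter.Tendsto (fun n => ∫ x, g x * (ψ x * η (c n • x))) Filter.atTop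
      (nhds (∫ x, g x * ψ x)) := by
    refine tendsto_integral_of_dominated_convergence
      (fun x => ‖g‖ * ‖ψ x‖) (fun n => ?_) (h1.norm.const_mul _) (fun n => ?_) ?_
    · exact (Lp.aestronglyMeasurable g).mul
        (h1.aestronglyMeasurable.mul (hηm n).aestronglyMeasurable)
    · filter_upwards [g.ae_norm_le] with x hx
      rw [norm_mul, norm_mul]
      refine mul_le_mul hx (mul_le_of_le_one_right (norm_nonneg _) (hη1 _)) (by positivity)
        (norm_nonneg _)
    · refine .of_forall fun x => Filter.Tendsto.const_mul _ ?_
      simpa using (hηx x).const_mul (ψ x)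
  simp only [key] at l1
  exact tendsto_nhds_unique l1 l2.neg

/-- The distribution associated with a real bounded function. -/
def distr (f : LInfty) : 𝓢'(E3, ℂ) :=
  ((Complex.ofRealCLM.compLp f : Lp ℂ ∞ (volume : Measure E3)) : 𝓢'(E3, ℂ))

theorem distr_apply (f : LInfty) (φ : 𝓢(E3, ℂ)) : distr f φ = ∫ x, φ x * (f x : ℂ) := by
  rw [distr, Lp.toTemperedDistribution_apply]
  refine integral_congr_ae ?_
  filter_upwards [Complex.ofRealCLM.coeFn_compLp f] with x hx
  rw [hx, smul_eq_mul, Complex.ofRealCLM_apply]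

theorem HasWeakPartial.distr_lineDeriv (h : HasWeakPartial i f g) (φ : 𝓢(E3, ℂ)) :
    distr f (∂_{EuclideanSpace.single i (1 : ℝ)} φ) = -distr g φ := by
  have hint : ∀ (k : LInfty) (φ : 𝓢(E3, ℂ)), Integrable fun x => φ x * (k x : ℂ) := by
    intro k φ
    refine φ.integrable.mul_bdd (c := ‖k‖)
      (Complex.continuous_ofReal.comp_aestronglyMeasurable (Lp.aestronglyMeasurable k)) ?_
    filter_upwards [k.ae_norm_le] with x hx
    rwa [Complex.norm_real]
  -- Weak derivatives are tested on real functions, so the real and imaginary parts of `φ` are used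
  -- separately.
  have main : ∀ L : ℂ →L[ℝ] ℝ, (∀ (z : ℂ) (r : ℝ), L (z * r) = r * L z) →
      L (distr f (∂_{EuclideanSpace.single i (1 : ℝ)} φ)) = L (-distr g φ) := by
    intro L hL
    have hd : ∀ x, fderiv ℝ (fun y => L (φ y)) x (EuclideanSpace.single i (1 : ℝ)) =
        L ((∂_{EuclideanSpace.single i (1 : ℝ)} φ) x) := by
      intro x
      rw [SchwartzMap.lineDerivOp_apply_eq_fderiv]
      exact DFunLike.congr_fun (L.hasFDerivAt.comp x (φ.hasFDerivAt x)).fderiv _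
    have := h.integral_eq_of_integrable (ψ := fun y => L (φ y)) (L.contDiff.comp (φ.smooth ⊤))
      (L.integrable_comp φ.integrable) (by
        simp only [hd]
        exact L.integrable_comp (SchwartzMap.integrable _))
    simp only [hd] at this
    rw [map_neg, distr_apply, distr_apply, ← L.integral_comp_comm (hint _ _),
      ← L.integral_comp_comm (hint _ _)]
    simp only [hL]
    exact this
  refine Complex.ext (main Complex.reCLM fun z r => ?_) (main Complex.imCLM fun z r => ?_)
  · simp [mul_comm]
  · simp [mul_comm]

end WeakDerivative

end Multiplication

/-! ### Multiplication by W^{2,∞} functions preserves H² -/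

noncomputable section SobolevMultiplication

open scoped LineDeriv BoundedContinuousFunction

/-- The product of two Schwartz functions. -/
def smulS (F φ : 𝓢(E3, ℂ)) : 𝓢(E3, ℂ) := SchwartzMap.smulLeftCLM ℂ F φ

theorem smulS_apply (F φ : 𝓢(E3, ℂ)) (x : E3) : smulS F φ x = F x * φ x :=
  SchwartzMap.smulLeftCLM_apply_apply F.hasTemperateGrowth φ x

theorem lineDeriv_smulS (m : E3) (F φ : 𝓢(E3, ℂ)) :
    ∂_{m} (smulS F φ) = smulS F (∂_{m} φ) + smulS (∂_{m} F) φ := by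
  ext x
  rw [add_apply, smulS_apply, smulS_apply, SchwartzMap.lineDerivOp_apply_eq_fderiv,
    SchwartzMap.lineDerivOp_apply_eq_fderiv, SchwartzMap.lineDerivOp_apply_eq_fderiv]
  have : (smulS F φ : E3 → ℂ) = fun x => F x * φ x := funext (smulS_apply F φ)
  rw [this, fderiv_fun_mul F.differentiableAt φ.differentiableAt]
  simp only [add_apply, smul_apply, smul_eq_mul]
  ring

/-- Leibniz's rule read backwards, F∂²φ = ∂²(Fφ) - 2∂(∂F φ) + (∂²F)φ, makes each outer derivative
fall on V. This is the weak form of ∂²(VF) = hF + 2g∂F + V∂²F. -/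
theorem distr_smulS_lineDeriv_lineDeriv {i : Fin 3} {V g h : LInfty} (hg : HasWeakPartial i V g)
    (hh : HasWeakPartial i g h) (F φ : 𝓢(E3, ℂ)) {e : E3} (he : e = EuclideanSpace.single i 1) :
    distr V (smulS F (∂_{e} (∂_{e} φ))) =
      distr h (smulS F φ) + 2 * distr g (smulS (∂_{e} F) φ) +
        distr V (smulS (∂_{e} (∂_{e} F)) φ) := by
  have e1 : smulS F (∂_{e} (∂_{e} φ)) =
      ∂_{e} (∂_{e} (smulS F φ)) - (2 : ℂ) • ∂_{e} (smulS (∂_{e} F) φ) +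
        smulS (∂_{e} (∂_{e} F)) φ := by
    rw [lineDeriv_smulS, LineDeriv.lineDerivOp_add, lineDeriv_smulS, lineDeriv_smulS, two_smul]
    abel
  rw [e1, map_add, map_sub, map_smul, he, hg.distr_lineDeriv, hh.distr_lineDeriv,
    hg.distr_lineDeriv, smul_eq_mul]
  ring

theorem coe_mulL2_toLp_apply (m : LInfty) (F φ : 𝓢(E3, ℂ)) :
    (mulL2 m (F.toLp 2) : 𝓢'(E3, ℂ)) φ = distr m (smulS F φ) := by
  rw [Lp.toTemperedDistribution_apply, distr_apply]
  refine integral_congr_ae ?_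
  filter_upwards [coeFn_mulL2 m (F.toLp 2), F.coeFn_toLp 2 volume] with x h1 h2
  rw [h1, h2, smulS_apply, smul_eq_mul]
  ring

/-- If the distributional Laplacian of `u ∈ L²` is in `L²` then `u ∈ H²`. -/
theorem eq_res_of_laplacian_eq {u g : L2} (h : Δ (u : 𝓢'(E3, ℂ)) = (g : 𝓢'(E3, ℂ))) :
    u = res (u - (lapConst : ℂ)⁻¹ • g) := by
  have hc : (lapConst : ℂ) ≠ 0 := by exact_mod_cast lapConst_pos.ne'
  -- The symbol of `res` composed with Δ is, up to the factor -4π², equal to 1 - (1 + ‖ξ‖²)⁻¹.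
  have e : res g = -((lapConst : ℂ) • (u - res u)) := by
    apply coe_L2_injective
    simp only
    rw [coe_res, ← h, TemperedDistribution.besselPotential_neg_two_laplacian_eq]
    have e : (fun ξ : E3 => Complex.ofReal (‖ξ‖ ^ 2 * (1 + ‖ξ‖ ^ 2) ^ (-1 : ℝ))) =
        ⇑(1 - resSymbol) := by
      ext ξ
      rw [BoundedContinuousFunction.sub_apply, BoundedContinuousFunction.coe_one,
        Pi.one_apply, resSymbol_apply, Real.rpow_neg_one]
      have : (1 : ℝ) + ‖ξ‖ ^ 2 ≠ 0 := by positivity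
      have h : ‖ξ‖ ^ 2 * (1 + ‖ξ‖ ^ 2)⁻¹ = 1 - (1 + ‖ξ‖ ^ 2)⁻¹ := by field_simp; ring
      exact_mod_cast h
    have hg : Function.HasTemperateGrowth (⇑(1 - resSymbol) : E3 → ℂ) :=
      (Function.HasTemperateGrowth.const 1).sub hasTemperateGrowth_resSymbol
    rw [e, ← coe_fm hg, ← Lp.toTemperedDistributionCLM_apply, ← Lp.toTemperedDistributionCLM_apply,
      map_sub fm, sub_apply, fm_one, map_neg, map_smul]
    rw [show (-(2 * Real.pi) ^ 2 : ℝ) = -lapConst from rfl, neg_smul]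
    rfl
  rw [map_sub, map_smul, e, smul_neg, smul_smul, inv_mul_cancel₀ hc, one_smul]
  abel

theorem laplacian_mulL2_toLp {V : LInfty} {g h : Fin 3 → LInfty}
    (hg : ∀ i, HasWeakPartial i V (g i)) (hh : ∀ i, HasWeakPartial i (g i) (h i))
    (F : 𝓢(E3, ℂ)) :
    Δ (mulL2 V (F.toLp 2) : 𝓢'(E3, ℂ)) =
      ((mulL2 V ((Δ F).toLp 2) + ∑ i, (mulL2 (h i) (F.toLp 2) + (2 : ℂ) • mulL2 (g i)
        ((∂_{EuclideanSpace.single i (1 : ℝ)} F).toLp 2)) : L2) : 𝓢'(E3, ℂ)) := by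
  ext φ
  have hL : ∀ F : 𝓢(E3, ℂ), Δ F = ∑ i : Fin 3, ∂_{EuclideanSpace.single i (1 : ℝ)}
      (∂_{EuclideanSpace.single i (1 : ℝ)} F) := by
    intro F
    rw [SchwartzMap.laplacian_eq_sum (EuclideanSpace.basisFun (Fin 3) ℝ)]
    simp
  have hl : ∀ (F : 𝓢(E3, ℂ)) (Φ : Fin 3 → 𝓢(E3, ℂ)), smulS F (∑ i, Φ i) = ∑ i, smulS F (Φ i) :=
    fun F Φ => map_sum _ _ _
  have hr : ∀ (Φ : Fin 3 → 𝓢(E3, ℂ)) (F : 𝓢(E3, ℂ)), smulS (∑ i, Φ i) F = ∑ i, smulS (Φ i) F := by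
    intro Φ F
    ext x
    simp only [smulS_apply, sum_apply, Finset.sum_mul]
  rw [TemperedDistribution.laplacian_apply_apply, coe_mulL2_toLp_apply, hL φ, hl, map_sum]
  simp only [← Lp.toTemperedDistributionCLM_apply, map_add, map_sum, map_smul]
  simp only [Lp.toTemperedDistributionCLM_apply, add_apply, sum_apply, smul_apply,
    coe_mulL2_toLp_apply]
  rw [hL F, hr, map_sum, ← Finset.sum_add_distrib]
  refine Finset.sum_congr rfl fun i _ => ?_
  rw [distr_smulS_lineDeriv_lineDeriv (hg i) (hh i) F φ rfl, smul_eq_mul]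
  ring

/-- The symbol of `∂ᵢ (1 - (4π²)⁻¹ Δ)⁻¹`. -/
def derivSymbol (i : Fin 3) : E3 →ᵇ ℂ :=
  BoundedContinuousFunction.ofNormedAddCommGroup
    (fun ξ => (2 * Real.pi * Complex.I) * (((ξ i * (1 + ‖ξ‖ ^ 2)⁻¹ : ℝ)) : ℂ))
    (continuous_const.mul (Complex.continuous_ofReal.comp (Continuous.mul (by fun_prop)
      (Continuous.inv₀ (by fun_prop) fun ξ => by positivity)))) (2 * Real.pi)
    (fun ξ => by
      have hpi := Real.pi_pos
      have h1 : ‖(2 * Real.pi * Complex.I : ℂ)‖ = 2 * Real.pi := by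
        simp [abs_of_pos hpi]
      rw [norm_mul, h1, Complex.norm_real]
      refine mul_le_of_le_one_right (by positivity) ?_
      rw [norm_mul, norm_inv, Real.norm_of_nonneg (by positivity : 0 ≤ 1 + ‖ξ‖ ^ 2),
        ← div_eq_mul_inv, div_le_one (by positivity)]
      have := PiLp.norm_apply_le ξ i
      nlinarith [sq_nonneg (‖ξ‖ - 1)])

theorem derivSymbol_eq (i : Fin 3) : (derivSymbol i : E3 → ℂ) =
    (2 * Real.pi * Complex.I) • ((resSymbol : E3 → ℂ) * fun ξ : E3 =>
      ((inner ℝ ξ (EuclideanSpace.single i (1 : ℝ)) : ℝ) : ℂ)) := by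
  ext ξ
  rw [Pi.smul_apply, Pi.mul_apply, resSymbol_apply, EuclideanSpace.inner_single_right, smul_eq_mul]
  change (2 * Real.pi * Complex.I) * (((ξ i * (1 + ‖ξ‖ ^ 2)⁻¹ : ℝ)) : ℂ) = _
  simp [mul_comm]

/-- Writes ∂ᵢF as a bounded operator applied to `w`, so that the Leibniz formula can be extended by
density. -/
theorem fm_derivSymbol {i : Fin 3} {w : L2} {F : 𝓢(E3, ℂ)} (hF : F.toLp 2 = res w) :
    fm (derivSymbol i) w = (∂_{EuclideanSpace.single i (1 : ℝ)} F).toLp 2 := by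
  have ht : Function.HasTemperateGrowth ((resSymbol : E3 → ℂ) * fun ξ : E3 =>
      ((inner ℝ ξ (EuclideanSpace.single i (1 : ℝ)) : ℝ) : ℂ)) :=
    hasTemperateGrowth_resSymbol.mul (by fun_prop)
  have ht' : Function.HasTemperateGrowth (derivSymbol i : E3 → ℂ) := by
    rw [derivSymbol_eq]
    exact (Function.HasTemperateGrowth.const _).mul ht
  apply coe_L2_injective
  simp only
  rw [Lp.toTemperedDistribution_toLp_eq, ← TemperedDistribution.lineDerivOp_toTemperedDistributionCLM_eq,
    ← Lp.toTemperedDistribution_toLp_eq (p := 2), hF, coe_fm ht',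
    TemperedDistribution.lineDeriv_eq_fourierMultiplierCLM, res, coe_fm hasTemperateGrowth_resSymbol,
    TemperedDistribution.fourierMultiplierCLM_fourierMultiplierCLM_apply
      hasTemperateGrowth_resSymbol (by fun_prop), derivSymbol_eq,
    TemperedDistribution.fourierMultiplierCLM_smul ht]
  rfl

theorem res_toLp (W : 𝓢(E3, ℂ)) :
    (SchwartzMap.fourierMultiplierCLM ℂ (resSymbol : E3 → ℂ) W).toLp 2 = res (W.toLp 2) := by
  apply coe_L2_injective
  simp only
  rw [res, coe_fm hasTemperateGrowth_resSymbol, Lp.toTemperedDistribution_toLp_eq,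
    Lp.toTemperedDistribution_toLp_eq,
    TemperedDistribution.fourierMultiplierCLM_toTemperedDistributionCLM_eq
      hasTemperateGrowth_resSymbol]

theorem toLp_laplacian {F : 𝓢(E3, ℂ)} {w : L2} (hF : F.toLp 2 = res w) :
    (Δ F).toLp 2 volume = (lapConst : ℂ) • (F.toLp 2 volume - w) := by
  have h := (memH2_res w).laplacian_eq
  rw [lap_res, ← hF, Lp.toTemperedDistribution_toLp_eq,
    TemperedDistribution.laplacian_toTemperedDistributionCLM_eq,
    ← Lp.toTemperedDistribution_toLp_eq (p := 2)] at h
  exact coe_L2_injective h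

/-- Multiplication by `V ∈ W^{2,∞}`, conjugated by the resolvent: it is bounded on `L²`, that is,
multiplication by `V` is bounded on `H²`. -/
theorem MemW2Infty.exists_conj {V : LInfty} (hV : MemW2Infty V) :
    ∃ M : L2 →L[ℂ] L2, ∀ w, res (M w) = mulL2 V (res w) := by
  choose g hg h' using hV
  -- Only the pure second derivatives occur in the Laplacian.
  choose h hh using fun i => h' i i
  have hc : (lapConst : ℂ) ≠ 0 := by exact_mod_cast lapConst_pos.ne'
  -- With c = 4π², u = V res w satisfies u = res (u - c⁻¹Δu). In Δu the term VΔ(res w) equals cV(res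
  -- w - w), so u cancels and V w remains, minus c⁻¹ times the terms containing derivatives of V.
  refine ⟨mulOp V - (lapConst : ℂ)⁻¹ • ∑ i, ((mulOp (h i)).comp res +
    (2 : ℂ) • (mulOp (g i)).comp (fm (derivSymbol i))), fun w => ?_⟩
  have hd : DenseRange (SchwartzMap.toLpCLM ℝ ℂ 2 (volume : Measure E3)) :=
    SchwartzMap.denseRange_toLpCLM ENNReal.ofNat_ne_top
  -- Both sides are continuous in `w`, and for Schwartz `w` the function res w is Schwartz, so the
  -- Leibniz formula applies.
  refine hd.induction_on (p := fun w => res ((mulOp V - (lapConst : ℂ)⁻¹ • ∑ i, ((mulOp (h i)).comp res +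
    (2 : ℂ) • (mulOp (g i)).comp (fm (derivSymbol i)))) w) = mulL2 V (res w)) w ?_ fun W => ?_
  · refine isClosed_eq ?_ ?_
    · exact (res.comp _).continuous
    · exact ((mulOp V).comp res).continuous
  · rw [SchwartzMap.toLpCLM_apply]
    obtain ⟨F, e1⟩ : ∃ F : 𝓢(E3, ℂ), F.toLp 2 volume = res (W.toLp 2 volume) := ⟨_, res_toLp W⟩
    have e2 := toLp_laplacian e1
    have e3 := eq_res_of_laplacian_eq (laplacian_mulL2_toLp hg hh F)
    rw [← e1, e3]
    congr 1
    simp only [sub_apply, smul_apply, sum_apply, add_apply, ContinuousLinearMap.comp_apply,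
      mulOp_apply, ← e1, fm_derivSymbol e1]
    rw [smul_add, e2, ← mulOp_apply V (_ • _), map_smul, smul_smul, inv_mul_cancel₀ hc, one_smul,
      map_sub, mulOp_apply, mulOp_apply]
    abel

end SobolevMultiplication

/-! ### Interaction picture: strong solutions and trajectories of the bounded system -/

noncomputable section InteractionPicture

local notation "⟪" x ", " y "⟫" => inner ℝ x y

theorem ofReal_smul_L2 (r : ℝ) (x : L2) : (r : ℂ) • x = r • x := algebraMap_smul ℂ r x

theorem real_inner_evo (t : ℝ) (f g : L2) : ⟪evo t f, g⟫ = ⟪f, evo (-t) g⟫ := by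
  rw [real_inner_L2, inner_evo, ← real_inner_L2]

theorem eq_of_forall_inner_res_res {x y : L2} (h : ∀ z, ⟪res (res z), x⟫ = ⟪res (res z), y⟫) :
    x = y := by
  refine dense_range_res_res.eq_of_inner_right (𝕜 := ℝ) ?_
  rintro _ ⟨z, rfl⟩
  exact h z

theorem bddFamily_evo : BddFamily (fun s => (evo s).restrictScalars ℝ) 1 :=
  ⟨continuous_evo, fun s => by rw [ContinuousLinearMap.norm_restrictScalars]; exact norm_evo_le s⟩

theorem bddFamily_evo_neg : BddFamily (fun s => (evo (-s)).restrictScalars ℝ) 1 :=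
  ⟨fun x => (continuous_evo x).comp continuous_neg, fun s => bddFamily_evo.bound (-s)⟩

/-- The operator `A` in the interaction picture. -/
def interaction (A : L2 →L[ℂ] L2) (s : ℝ) : L2 →L[ℝ] L2 :=
  ((evo (-s)).comp (A.comp (evo s))).restrictScalars ℝ

theorem interaction_apply (A : L2 →L[ℂ] L2) (s : ℝ) (x : L2) :
    interaction A s x = evo (-s) (A (evo s x)) := rfl

theorem bddFamily_interaction (A : L2 →L[ℂ] L2) : BddFamily (interaction A) ‖A‖ where
  cont x := bddFamily_evo_neg.continuous_apply (A.continuous.comp (continuous_evo x))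
  bound s := ContinuousLinearMap.opNorm_le_bound _ (norm_nonneg _) fun x => by
    rw [interaction_apply, norm_evo, ← norm_evo s x]
    exact A.le_opNorm _

/-- The system `y' = -i e^{-isΔ} (A - ε B) e^{isΔ} y`. -/
def interactionSystem {T : ℝ} (hT : 0 ≤ T) (A B : L2 →L[ℂ] L2) : ControlSystem L2 T where
  nonneg := hT
  p := interaction (-Complex.I • A)
  q := interaction (Complex.I • B)
  Cp := ‖-Complex.I • A‖
  Cq := ‖Complex.I • B‖
  hp := bddFamily_interaction _
  hq := bddFamily_interaction _

/-- Skew-symmetry of iΔ, which generates the group: the Laplacian passes from the smooth test vector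
to an element of H². -/
theorem inner_deriv_evo_res_res (z w : L2) (t : ℝ) :
    ⟪(-(lapConst * Complex.I)) • evo t (res z - res (res z)), res w⟫ =
      -⟪evo t (res (res z)), Complex.I • lap (res w)⟫ := by
  have h : inner ℂ (evo t (res z)) (res w) = inner ℂ (evo t (res (res z))) w := by
    rw [← inner_res, evo_res t (res z)]
  rw [real_inner_L2, real_inner_L2, lap_res, inner_smul_left, map_sub, inner_sub_left, h,
    inner_smul_right, inner_smul_right, inner_sub_right, ← Complex.neg_re]
  congr 1
  simp only [map_neg, map_mul, Complex.conj_ofReal, Complex.conj_I]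
  ring

/-- Duhamel's formula. -/
theorem evo_primitive {T σ : ℝ} {v v' G : ℝ → L2} {a b : ℝ} (ha : a ∈ Set.Icc 0 T)
    (hb : b ∈ Set.Icc 0 T) (hv' : IntervalIntegrable v' volume a b)
    (hv : ∀ t ∈ Set.uIcc a b, v t = v a + ∫ s in a..t, v' s)
    (hG : IntervalIntegrable G volume a b)
    (h : ∀ᵐ s ∂(volume.restrict (Set.Ioo 0 T)), MemH2 (v s) ∧
      evo (-(σ * s)) (v' s - σ • Complex.I • lap (v s)) = G s) :
    evo (-(σ * b)) (v b) = evo (-(σ * a)) (v a) + ∫ s in a..b, G s := by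
  -- The group is only strongly continuous on L², so it is moved onto a dense set of test vectors
  -- along which it is differentiable. The value σ = 1 removes the free evolution and σ = -1
  -- restores it.
  refine eq_of_forall_inner_res_res fun z => ?_
  set y : ℝ → L2 := fun s => evo (σ * s) (res (res z)) with hy
  set y' : ℝ → L2 := fun s =>
    σ • ((-(lapConst * Complex.I)) • evo (σ * s) (res z - res (res z))) with hy'
  have hec : ∀ x, Continuous fun s => evo (σ * s) x := fun x =>
    (continuous_evo x).comp (continuous_const.mul continuous_id)
  have hyc : Continuous y' := ((hec (res z - res (res z))).const_smul
    (-(lapConst * Complex.I))).const_smul σ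
  have hyd : ∀ s, HasDerivAt y (y' s) s := fun s => by
    have h2 : HasDerivAt (fun s : ℝ => σ * s) σ s := by
      simpa using (hasDerivAt_id s).const_mul σ
    exact (hasDerivAt_evo_res_res z (σ * s)).scomp s h2
  have hyp : ∀ t ∈ Set.uIcc a b, y t = y a + ∫ s in a..t, y' s := fun t _ => by
    rw [intervalIntegral.integral_eq_sub_of_hasDerivAt (fun s _ => hyd s)
      (hyc.intervalIntegrable _ _)]
    abel
  have key : ⟪y b, v b⟫ = ⟪y a, v a⟫ + ∫ s in a..b, (⟪y' s, v s⟫ + ⟪y s, v' s⟫) :=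
    (bilin_primitive (innerSL ℝ) (hyc.intervalIntegrable _ _) hv' hyp hv).2
  have e : ∫ s in a..b, (⟪y' s, v s⟫ + ⟪y s, v' s⟫) = ∫ s in a..b, ⟪res (res z), G s⟫ := by
    refine intervalIntegral_congr_of_ae_Ioo ?_ ha hb
    filter_upwards [h] with s hs
    obtain ⟨w, hw⟩ := (memH2_iff _).1 hs.1
    rw [← hs.2, ← real_inner_evo, inner_sub_right, real_inner_smul_right, hw]
    simp only [hy', hy]
    rw [real_inner_smul_left, inner_deriv_evo_res_res]
    ring
  have e' : ∫ s in a..b, ⟪res (res z), G s⟫ = ⟪res (res z), ∫ s in a..b, G s⟫ :=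
    (innerSL ℝ (res (res z))).intervalIntegral_comp_comm hG
  rw [inner_add_right, ← real_inner_evo, ← real_inner_evo, ← e', ← e]
  exact key

section Solutions

variable {V μ : LInfty} {T : ℝ} {ε : L2T T}

/-- Strong solutions are trajectories of the interaction picture system. -/
theorem IsSchrodingerSolution.exists_eq_sol (hT : 0 ≤ T) {u : ℝ → L2}
    (hu : IsSchrodingerSolution V μ T ε u) :
    ∃ y : C(Set.Icc 0 T, L2), (∀ t : Set.Icc 0 T, u t = evo t (y t)) ∧ ∀ τ,
      y = (interactionSystem hT (mulOp V) (mulOp μ)).sol τ ε (ControlSystem.constL (y τ)) := by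
  set S := interactionSystem hT (mulOp V) (mulOp μ) with hS
  obtain ⟨⟨C, hC⟩, u', hu', hu0, heq⟩ := hu
  have huc : ContinuousOn u (Set.Icc 0 T) := by
    have := continuousOn_of_eq_primitive hu' (y := u) (by rwa [Set.uIcc_of_le hT])
    rwa [Set.uIcc_of_le hT] at this
  set y : C(Set.Icc 0 T, L2) := ⟨fun t => evo (-t) (u t),
    (bddFamily_evo_neg.continuousOn_apply huc).domRestrict⟩ with hy
  have hyu : ∀ s ∈ Set.Icc 0 T, evo s (S.ext y s) = u s := fun s hs => by
    rw [S.ext_apply y hs]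
    exact evo_evo_neg s _
  refine ⟨y, fun t => (evo_evo_neg _ _).symm, fun τ => (S.sol_eq_iff τ ε _ _).2 ?_⟩
  ext1 t
  rw [ContinuousMap.add_apply, S.gen_apply, ControlSystem.constL_apply,
    ContinuousMap.const_apply]
  have hI : ∀ {a b : ℝ}, a ∈ Set.Icc 0 T → b ∈ Set.Icc 0 T → IntervalIntegrable u' volume a b :=
    fun ha hb => hu'.mono_set (by rw [Set.uIcc_of_le hT]; exact Set.uIcc_subset_Icc ha hb)
  have h0 : (0 : ℝ) ∈ Set.Icc 0 T := Set.left_mem_Icc.2 hT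
  have key := evo_primitive (σ := 1) (v := u) τ.2 t.2 (hI τ.2 t.2) (fun t' ht' => by
    have ht := Set.uIcc_subset_Icc τ.2 t.2 ht'
    rw [hu0 t' ht, hu0 τ τ.2, add_assoc,
      intervalIntegral.integral_add_adjacent_intervals (hI h0 τ.2) (hI τ.2 ht)])
    (S.intervalIntegrable_gen ε y τ t) (by
      filter_upwards [hC, heq, ae_restrict_mem measurableSet_Ioo] with s h1 h2 hs
      refine ⟨h1.1, ?_⟩
      -- The equation solved for `u'`. Its Laplacian term is the one subtracted in Duhamel's
      -- formula, which leaves only bounded terms.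
      have h3 : u' s = Complex.I • lap (u s) - Complex.I • mulL2 V (u s) +
          ε s • Complex.I • mulL2 μ (u s) := by
        have h4 := congrArg (fun x => -Complex.I • x) (sub_eq_zero.1 h2)
        simp only [smul_smul, neg_mul, Complex.I_mul_I, neg_neg, one_smul] at h4
        rw [h4, hamiltonian, ofReal_smul_L2, smul_comm (ε s) Complex.I]
        module
      have h5 : S.p s (S.ext y s) = evo (-s) (-Complex.I • mulL2 V (u s)) := by
        rw [← hyu s (Set.Ioo_subset_Icc_self hs)]; rfl
      have h6 : S.q s (S.ext y s) = evo (-s) (Complex.I • mulL2 μ (u s)) := by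
        rw [← hyu s (Set.Ioo_subset_Icc_self hs)]; rfl
      rw [h5, h6, h3, one_mul, one_smul, ← ofReal_smul_L2 (ε s), ← ofReal_smul_L2 (ε s),
        ← map_smul (evo (-s)) (ε s : ℂ), ← map_add]
      congr 1
      rw [neg_smul]
      abel)
  simp only [one_mul] at key
  exact key

set_option maxHeartbeats 1000000 in
/-- Existence of strong solutions with values in `H²`. -/
theorem exists_isSchrodingerSolution (hT : 0 ≤ T) (hV : MemW2Infty V) (hμ : MemW2Infty μ)
    (ε : L2T T) (τ : Set.Icc 0 T) {f : L2} (hf : MemH2 f) :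
    ∃ u, IsSchrodingerSolution V μ T ε u ∧ u τ = f ∧ ∀ t, MemH2 (u t) := by
  obtain ⟨A, hA⟩ := hV.exists_conj
  obtain ⟨B, hB⟩ := hμ.exists_conj
  obtain ⟨w, rfl⟩ := (memH2_iff f).1 hf
  -- The system uses the conjugated operators, which need not be skew-adjoint; existence does not
  -- require it. Since res A = V res and res B = μ res, and `res` commutes with the group, e^{isΔ}
  -- res y solves the original equation with values in H².
  set S := interactionSystem hT A B with hS
  set y := S.sol τ ε (ControlSystem.constL (evo (-τ) w)) with hy
  set F : ℝ → L2 := fun s => S.p s (S.ext y s) + ε s • S.q s (S.ext y s) with hF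
  have hFi : ∀ a b : Set.Icc 0 T, IntervalIntegrable F volume a b := S.intervalIntegrable_gen ε y
  have hyt : ∀ t : Set.Icc 0 T, y t = evo (-τ) w + ∫ s in (τ : ℝ)..t, F s := fun t => by
    conv_lhs => rw [(S.sol_eq_iff τ ε _ _).1 hy]
    rw [ContinuousMap.add_apply, S.gen_apply]
    rfl
  set x : ℝ → L2 := fun s => evo s (S.ext y s) with hx
  have hxc : Continuous x := bddFamily_evo.continuous_apply (S.continuous_ext y)
  have huc : Continuous fun s => res (x s) := res.continuous.comp hxc
  have hlc : Continuous fun s => lap (res (x s)) := by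
    simp only [lap_res]
    exact (huc.sub hxc).const_smul (lapConst : ℂ)
  set G : ℝ → L2 := fun s => Complex.I • lap (res (x s)) - Complex.I • mulOp V (res (x s)) +
    ε s • Complex.I • mulOp μ (res (x s)) with hG
  have hGi : ∀ a b : Set.Icc 0 T, IntervalIntegrable G volume a b := fun a b =>
    (((hlc.const_smul Complex.I).sub (((mulOp V).continuous.comp huc).const_smul
      Complex.I)).intervalIntegrable _ _).add (ε.intervalIntegrable_smul
        (((mulOp μ).continuous.comp huc).const_smul Complex.I).continuousOn a.2 b.2)
  have hprim : ∀ a b : Set.Icc 0 T, res (x b) = res (x a) + ∫ s in (a : ℝ)..b, G s := by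
    intro a b
    have key := evo_primitive (σ := -1) (v := fun s => res (S.ext y s)) (v' := fun s => res (F s))
      (G := G) a.2 b.2 ⟨res.integrable_comp (hFi a b).1, res.integrable_comp (hFi a b).2⟩ (fun t' ht' => by
        have ht := Set.uIcc_subset_Icc a.2 b.2 ht'
        have e : ∫ s in (a : ℝ)..t', res (F s) = res (∫ s in (a : ℝ)..t', F s) :=
          res.intervalIntegral_comp_comm (hFi a ⟨t', ht⟩)
        rw [S.ext_apply y ht, S.ext_apply y a.2, hyt ⟨t', ht⟩, hyt a, e,
          ← intervalIntegral.integral_add_adjacent_intervals (hFi τ a) (hFi a ⟨t', ht⟩),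
          ← add_assoc, map_add]) (hGi a b) (.of_forall fun s => ⟨memH2_res _, ?_⟩)
    · simpa only [neg_mul, one_mul, neg_neg, evo_res] using key
    · have h1 : evo s (lap (res (S.ext y s))) = lap (res (x s)) := by
        rw [lap_res, lap_res, map_smul, map_sub, evo_res]
      have h2 : evo s (res (S.p s (S.ext y s))) = -Complex.I • mulOp V (res (x s)) := by
        rw [mulOp_apply, ← hA, ← map_smul, evo_res]
        exact congrArg res (evo_evo_neg s _)
      have h3 : evo s (res (S.q s (S.ext y s))) = Complex.I • mulOp μ (res (x s)) := by
        rw [mulOp_apply, ← hB, ← map_smul, evo_res]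
        exact congrArg res (evo_evo_neg s _)
      rw [neg_mul, one_mul, neg_neg, neg_smul, one_smul, sub_neg_eq_add, hF]
      simp only
      rw [← ofReal_smul_L2 (ε s), map_add res, map_add (evo s), map_add (evo s), map_smul res,
        map_smul (evo s), map_smul (evo s), h1, h2, h3, ofReal_smul_L2, hG]
      simp only
      rw [neg_smul]
      abel
  refine ⟨fun s => res (x s), ⟨?_, G, ?_, ?_, ?_⟩, ?_, fun t => memH2_res _⟩
  · obtain ⟨C, hC⟩ := (isCompact_Icc (a := (0 : ℝ)) (b := T)).exists_bound_of_continuousOn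
      (f := fun s => h2Norm (res (x s)))
      ((huc.norm.pow 2).add (hlc.norm.pow 2)).sqrt.continuousOn
    refine ⟨C, (ae_restrict_mem measurableSet_Ioo).mono fun s hs => ⟨memH2_res _, ?_⟩⟩
    exact (le_abs_self _).trans (hC s (Set.Ioo_subset_Icc_self hs))
  · exact hGi S.t0 S.t1
  · exact fun t ht => hprim S.t0 ⟨t, ht⟩
  · refine .of_forall fun s => ?_
    simp only [hG, hamiltonian, mulOp_apply, ofReal_smul_L2, smul_add, smul_sub, smul_smul,
      Complex.I_mul_I, neg_smul, one_smul, smul_comm Complex.I (ε s)]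
    rw [smul_neg]
    abel
  · have : S.ext y τ = evo (-τ) w := by
      rw [S.ext_apply y τ.2, hyt ⟨τ, τ.2⟩, intervalIntegral.integral_same, add_zero]
    simp only [hx, this, evo_evo_neg]

end Solutions

end InteractionPicture

/-! ### The control problem in the interaction picture -/

noncomputable section Control

theorem real_inner_interaction {A : L2 →L[ℂ] L2} {c c' : ℂ}
    (hA : ∀ f g, inner ℂ (A f) g = inner ℂ f (A g)) (hc : (starRingEnd ℂ) c = c') (s : ℝ)
    (x y : L2) :
    inner ℝ (interaction (c • A) s x) y = inner ℝ x (interaction (c' • A) s y) := by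
  rw [interaction_apply, interaction_apply, real_inner_L2, real_inner_L2, inner_evo, neg_neg,
    ← inner_evo, smul_apply, smul_apply, inner_smul_left, inner_smul_right, hA, hc]

theorem interactionSystem_isSkew {T : ℝ} (hT : 0 ≤ T) (V μ : LInfty) :
    (interactionSystem hT (mulOp V) (mulOp μ)).IsSkew where
  p s x y := by
    have h : inner ℝ (interaction (-Complex.I • mulOp V) s x) y =
        inner ℝ x (interaction (Complex.I • mulOp V) s y) :=
      real_inner_interaction (inner_mulL2 V) (by simp) s x y
    refine h.trans ?_
    rw [← inner_neg_right]
    change _ = inner ℝ x (-interaction (-Complex.I • mulOp V) s y)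
    rw [interaction_apply, interaction_apply, smul_apply, smul_apply, neg_smul, map_neg, neg_neg]
  q s x y := by
    have h : inner ℝ (interaction (Complex.I • mulOp μ) s x) y =
        inner ℝ x (interaction (-Complex.I • mulOp μ) s y) :=
      real_inner_interaction (inner_mulL2 μ) (by simp) s x y
    refine h.trans ?_
    rw [← inner_neg_right]
    change _ = inner ℝ x (-interaction (Complex.I • mulOp μ) s y)
    rw [interaction_apply, interaction_apply, smul_apply, smul_apply, neg_smul, map_neg]

theorem interactionSystem_Cq_le {T : ℝ} (hT : 0 ≤ T) (A : L2 →L[ℂ] L2) (μ : LInfty) :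
    (interactionSystem hT A (mulOp μ)).Cq ≤ ‖μ‖ := by
  change ‖Complex.I • mulOp μ‖ ≤ ‖μ‖
  rw [norm_smul, Complex.norm_I, one_mul]
  exact LinearMap.mkContinuous_norm_le _ (norm_nonneg _) _

section States

variable {V μ : LInfty} {T : ℝ} {ε : L2T T}

/-- A strong solution is determined by its value at any single time; taking 0 or T gives uniqueness
of the state or of the adjoint state. -/
theorem IsSchrodingerSolution.eq_sol (hT : 0 ≤ T) {u : ℝ → L2}
    (hu : IsSchrodingerSolution V μ T ε u) (τ t : Set.Icc 0 T) :
    u t = evo t ((interactionSystem hT (mulOp V) (mulOp μ)).sol τ ε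
      (ControlSystem.constL (evo (-τ) (u τ))) t) := by
  obtain ⟨y, hy, hsol⟩ := hu.exists_eq_sol hT
  rw [hy τ, evo_neg_evo, ← hsol τ, hy t]

theorem IsSchrodingerSolution.eqOn {u v : ℝ → L2} (hu : IsSchrodingerSolution V μ T ε u)
    (hv : IsSchrodingerSolution V μ T ε v) {τ : ℝ} (hτ : τ ∈ Set.Icc 0 T) (h : u τ = v τ) :
    Set.EqOn u v (Set.Icc 0 T) := by
  intro t ht
  have hT : 0 ≤ T := hτ.1.trans hτ.2
  have e1 := hu.eq_sol hT ⟨τ, hτ⟩ ⟨t, ht⟩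
  have e2 := hv.eq_sol hT ⟨τ, hτ⟩ ⟨t, ht⟩
  simp only [h] at e1 e2
  rw [e1, e2]

variable (hT : 0 ≤ T) (hV : MemW2Infty V) (hμ : MemW2Infty μ) {ψ₀ : L2} (hψ₀ : MemH2 ψ₀)
  {O : L2 →L[ℂ] L2} (hO : IsObservable O) (ε)

include hT hV hμ hψ₀

theorem exists_isState : ∃ ψ, IsState V μ T ψ₀ ε ψ ∧ ∀ t, MemH2 (ψ t) := by
  obtain ⟨u, h1, h2, h3⟩ := exists_isSchrodingerSolution hT hV hμ ε
    ⟨0, Set.left_mem_Icc.2 hT⟩ hψ₀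
  exact ⟨u, ⟨h1, h2⟩, h3⟩

theorem isState_state : IsState V μ T ψ₀ ε (state V μ T ψ₀ ε) := by
  have h : ∃ ψ, IsState V μ T ψ₀ ε ψ := (exists_isState ε hT hV hμ hψ₀).imp fun _ h => h.1
  rw [state, dif_pos h]
  exact h.choose_spec

theorem eqOn_state {ψ : ℝ → L2} (hψ : IsState V μ T ψ₀ ε ψ) :
    Set.EqOn ψ (state V μ T ψ₀ ε) (Set.Icc 0 T) := by
  have h := isState_state ε hT hV hμ hψ₀
  exact hψ.1.eqOn h.1 (Set.left_mem_Icc.2 hT) (hψ.2.trans h.2.symm)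

theorem memH2_state {t : ℝ} (ht : t ∈ Set.Icc 0 T) : MemH2 (state V μ T ψ₀ ε t) := by
  obtain ⟨ψ, h1, h2⟩ := exists_isState ε hT hV hμ hψ₀
  exact eqOn_state ε hT hV hμ hψ₀ h1 ht ▸ h2 t

theorem state_eq_evo_fwd (t : Set.Icc 0 T) : state V μ T ψ₀ ε t =
    evo t ((interactionSystem hT (mulOp V) (mulOp μ)).fwd ψ₀ ε t) := by
  have h := isState_state ε hT hV hμ hψ₀
  have e := h.1.eq_sol hT ⟨0, Set.left_mem_Icc.2 hT⟩ t
  rwa [h.2, neg_zero, evo_zero] at e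

include hO

theorem exists_isAdjointState : ∃ χ, IsAdjointState V μ T O ψ₀ ε χ := by
  have hTm := Set.right_mem_Icc.2 hT
  obtain ⟨C, hC⟩ := hO.bounded_H2
  obtain ⟨u, h1, h2, -⟩ := exists_isSchrodingerSolution hT hV hμ ε ⟨T, hTm⟩
    (hC _ (memH2_state ε hT hV hμ hψ₀ hTm)).1
  exact ⟨u, h1, h2⟩

theorem isAdjointState_adjointState :
    IsAdjointState V μ T O ψ₀ ε (adjointState V μ T O ψ₀ ε) := by
  have h := exists_isAdjointState ε hT hV hμ hψ₀ hO
  rw [adjointState, dif_pos h]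
  exact h.choose_spec

theorem eqOn_adjointState {χ : ℝ → L2} (hχ : IsAdjointState V μ T O ψ₀ ε χ) :
    Set.EqOn χ (adjointState V μ T O ψ₀ ε) (Set.Icc 0 T) := by
  have h := isAdjointState_adjointState ε hT hV hμ hψ₀ hO
  exact hχ.1.eqOn h.1 (Set.right_mem_Icc.2 hT) (hχ.2.trans h.2.symm)

/-- In the interaction picture the final condition χ(T) = Oψ(T) involves the conjugated observable
e^{-iTΔ}O e^{iTΔ}. -/
theorem adjointState_eq_evo_bwd (t : Set.Icc 0 T) : adjointState V μ T O ψ₀ ε t =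
    evo t ((interactionSystem hT (mulOp V) (mulOp μ)).bwd (interaction O T) ψ₀ ε t) := by
  have h := isAdjointState_adjointState ε hT hV hμ hψ₀ hO
  have hTm := Set.right_mem_Icc.2 hT
  have e := h.1.eq_sol hT ⟨T, hTm⟩ t
  have e2 : state V μ T ψ₀ ε T = _ := state_eq_evo_fwd ε hT hV hμ hψ₀ ⟨T, hTm⟩
  rwa [h.2, e2] at e

/-- Unitarity removes the group, and Im⟨χ, μψ⟩ = -Re⟨χ, iμψ⟩ is minus the real inner product with q
= iμ in the interaction picture. -/
theorem gammaFun_eq_observe {t : ℝ} (ht : t ∈ Set.Icc 0 T) :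
    gammaFun V μ T O ψ₀ ε t = (interactionSystem hT (mulOp V) (mulOp μ)).observe
      ((interactionSystem hT (mulOp V) (mulOp μ)).bwd (interaction O T) ψ₀ ε)
      ((interactionSystem hT (mulOp V) (mulOp μ)).fwd ψ₀ ε) t := by
  have e1 : adjointState V μ T O ψ₀ ε t = _ :=
    adjointState_eq_evo_bwd ε hT hV hμ hψ₀ hO ⟨t, ht⟩
  have e2 : state V μ T ψ₀ ε t = _ := state_eq_evo_fwd ε hT hV hμ hψ₀ ⟨t, ht⟩
  rw [gammaFun, ControlSystem.observe, ControlSystem.ext_apply _ _ ht,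
    ControlSystem.ext_apply _ _ ht, e1, e2, real_inner_L2]
  change _ = -(inner ℂ _ (evo (-t) (Complex.I • mulL2 μ (evo t _)))).re
  rw [← inner_evo, inner_smul_right, Complex.I_mul_re, neg_neg]

theorem observe_ae_eq_gammaFun : (interactionSystem hT (mulOp V) (mulOp μ)).observe
      ((interactionSystem hT (mulOp V) (mulOp μ)).bwd (interaction O T) ψ₀ ε)
      ((interactionSystem hT (mulOp V) (mulOp μ)).fwd ψ₀ ε)
      =ᵐ[volume.restrict (Set.Ioo 0 T)] gammaFun V μ T O ψ₀ ε :=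
  (ae_restrict_mem measurableSet_Ioo).mono fun _ ht =>
    (gammaFun_eq_observe ε hT hV hμ hψ₀ hO (Set.Ioo_subset_Icc_self ht)).symm

theorem memLp_gammaFun : MemLp (gammaFun V μ T O ψ₀ ε) 2 (volume.restrict (Set.Ioo 0 T)) :=
  (ControlSystem.memLp_observe _ _ _).ae_eq (observe_ae_eq_gammaFun ε hT hV hμ hψ₀ hO)

theorem gammaMap_eq_observeL2 : gammaMap V μ T O ψ₀ ε =
    (interactionSystem hT (mulOp V) (mulOp μ)).observeL2
      ((interactionSystem hT (mulOp V) (mulOp μ)).bwd (interaction O T) ψ₀ ε)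
      ((interactionSystem hT (mulOp V) (mulOp μ)).fwd ψ₀ ε) := by
  have h := memLp_gammaFun ε hT hV hμ hψ₀ hO
  rw [gammaMap, dif_pos h]
  exact MemLp.toLp_congr _ (ControlSystem.memLp_observe _ _ _)
    (observe_ae_eq_gammaFun ε hT hV hμ hψ₀ hO).symm

omit hO in
theorem costJ_eq (α : ℝ) (O : L2 →L[ℂ] L2) : costJ V μ T α O ψ₀ ε =
    inner ℝ ((interactionSystem hT (mulOp V) (mulOp μ)).fwd ψ₀ ε
        (interactionSystem hT (mulOp V) (mulOp μ)).t1)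
      (interaction O T ((interactionSystem hT (mulOp V) (mulOp μ)).fwd ψ₀ ε
        (interactionSystem hT (mulOp V) (mulOp μ)).t1)) - α * ‖ε‖ ^ 2 := by
  have e2 : state V μ T ψ₀ ε T = _ :=
    state_eq_evo_fwd ε hT hV hμ hψ₀ ⟨T, Set.right_mem_Icc.2 hT⟩
  rw [costJ, e2, ← L2T.norm_sq, real_inner_L2, interaction_apply, ← inner_evo]
  rfl

theorem hasGradientAt_costJ (α : ℝ) : HasGradientAt (costJ V μ T α O ψ₀)
    ((-2 : ℝ) • (α • ε + gammaMap V μ T O ψ₀ ε)) ε := by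
  rw [funext fun ε => costJ_eq ε hT hV hμ hψ₀ α O, gammaMap_eq_observeL2 ε hT hV hμ hψ₀ hO]
  refine ControlSystem.hasGradientAt_cost (interactionSystem_isSkew hT V μ) α (fun x y => ?_) ψ₀ ε
  have := real_inner_interaction (A := O) (c := 1) (c' := 1)
    (fun f g => hO.positive.isSymmetric f g) (map_one _) T x y
  rwa [one_smul] at this

theorem hasFDerivAt_gammaMap (hn : ‖ψ₀‖ = 1) :
    ∃ D : L2T T →L[ℝ] L2T T, ‖D‖ ≤ 6 * T * ‖μ‖ ^ 2 * ‖O‖ ∧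
      HasFDerivAt (gammaMap V μ T O ψ₀) D ε := by
  obtain ⟨D, h1, h2⟩ := ControlSystem.hasFDerivAt_observeL2 (interactionSystem_isSkew hT V μ)
    (interaction O T) hn ε
  have h3 := interactionSystem_Cq_le hT (mulOp V) μ
  have h4 := (interactionSystem hT (mulOp V) (mulOp μ)).hq.nonneg
  refine ⟨D, h1.trans ?_, ?_⟩
  · gcongr
    exact (bddFamily_interaction O).bound T
  · rwa [show gammaMap V μ T O ψ₀ = _ from
      funext fun ε => gammaMap_eq_observeL2 ε hT hV hμ hψ₀ hO]

end States

/-- After division by cα, this is a Neumann series. -/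
theorem isUnit_smul_id_add {E : Type*} [NormedAddCommGroup E] [NormedSpace ℝ E] [CompleteSpace E]
    {c α : ℝ} (hc : c ≠ 0) (hα : α ≠ 0) {D : E →L[ℝ] E} (hD : ‖α⁻¹ • D‖ < 1) :
    IsUnit (c • (α • ContinuousLinearMap.id ℝ E + D)) := by
  have h1 : IsUnit (1 - -(α⁻¹ • D)) := isUnit_one_sub_of_norm_lt_one (by rwa [norm_neg])
  have h2 : c • (α • ContinuousLinearMap.id ℝ E + D) =
      Units.mk0 (c * α) (mul_ne_zero hc hα) • (1 - -(α⁻¹ • D)) := by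
    rw [Units.smul_mk0, sub_neg_eq_add, smul_add, smul_add, smul_smul, smul_smul, mul_assoc,
      mul_inv_cancel₀ hα, mul_one]
    rfl
  rw [h2]
  exact h1.smul _

end Control

theorem lemma4p5 (V μ : LInfty) (hV : MemW2Infty V) (hμ : MemW2Infty μ)
    (T α : ℝ) (hT : 0 < T)
    (O : L2 →L[ℂ] L2) (hO : IsObservable O)
    (ψ₀ : L2) (hψ₀ : MemH2 ψ₀) (hψ₀_norm : ‖ψ₀‖ = 1)
    (hα : 6 * T * ‖μ‖ ^ 2 * ‖O‖ < α) :
    -- the state and the adjoint state exist and are unique on `[0,T]`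
    (∀ ε : L2T T,
      (∃ ψ, IsState V μ T ψ₀ ε ψ) ∧
      (∀ ψ, IsState V μ T ψ₀ ε ψ → Set.EqOn ψ (state V μ T ψ₀ ε) (Set.Icc 0 T)) ∧
      (∃ χ, IsAdjointState V μ T O ψ₀ ε χ) ∧
      (∀ χ, IsAdjointState V μ T O ψ₀ ε χ →
        Set.EqOn χ (adjointState V μ T O ψ₀ ε) (Set.Icc 0 T)) ∧
      MemLp (gammaFun V μ T O ψ₀ ε) 2 (volume.restrict (Set.Ioo 0 T))) ∧
    -- `J` and `γ` are differentiable and `hessianJ` is the Hessian operator of `J`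
    Differentiable ℝ (costJ V μ T α O ψ₀) ∧
    Differentiable ℝ (gammaMap V μ T O ψ₀) ∧
    (∀ ε : L2T T,
      HasFDerivAt (gradient (costJ V μ T α O ψ₀)) (hessianJ V μ T α O ψ₀ ε) ε) ∧
    -- the criterion
    (∀ ε : L2T T,
      ‖α⁻¹ • fderiv ℝ (gammaMap V μ T O ψ₀) ε‖ < 1 ∧
      IsUnit (hessianJ V μ T α O ψ₀ ε)) := by
  have hT' := hT.le
  -- Positivity of `α` follows from the criterion, whose left side is nonnegative.
  have hα0 : 0 < α := lt_of_le_of_lt (by positivity) hα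
  choose D hDn hD using fun ε =>
    hasFDerivAt_gammaMap (V := V) (μ := μ) ε hT' hV hμ hψ₀ hO hψ₀_norm
  have hgrad := fun ε => hasGradientAt_costJ (V := V) (μ := μ) ε hT' hV hμ hψ₀ hO α
  have hlt : ∀ ε, ‖α⁻¹ • fderiv ℝ (gammaMap V μ T O ψ₀) ε‖ < 1 := fun ε => by
    rw [(hD ε).fderiv, norm_smul, norm_inv, Real.norm_of_nonneg hα0.le, inv_mul_lt_one₀ hα0]
    exact (hDn ε).trans_lt hα
  refine ⟨fun ε => ⟨(exists_isState ε hT' hV hμ hψ₀).imp fun _ h => h.1,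
    fun ψ h => eqOn_state ε hT' hV hμ hψ₀ h, exists_isAdjointState ε hT' hV hμ hψ₀ hO,
    fun χ h => eqOn_adjointState ε hT' hV hμ hψ₀ hO h, memLp_gammaFun ε hT' hV hμ hψ₀ hO⟩,
    fun ε => (hgrad ε).differentiableAt, fun ε => (hD ε).differentiableAt, fun ε => ?_,
    fun ε => ⟨hlt ε, isUnit_smul_id_add (by norm_num) hα0.ne' (hlt ε)⟩⟩
  -- The gradient equals -2(αε + γ(ε)) at every ε, so this expression can be differentiated in its
  -- place.
  rw [funext fun ε => (hgrad ε).gradient, hessianJ, (hD ε).fderiv]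
  exact (((hasFDerivAt_id ε).const_smul α).add (hD ε)).const_smul (-2 : ℝ)
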